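/- Let $\mathbf k$ be a field of characteristic zero and let $V=V_0\oplus V_1$ be a $\mathbb Z/2$-graded vector space over $\mathbf k$ with $\dim V_0=l$, $\dim V_1=n$ (both finite), with an odd differential $d$, $d^2=0$. Let $\hat S\Pi V^*=\mathbf k[[y_1,\dots,y_n]]\otimes\Lambda(x_1,\dots,x_l)$ be the algebra of formal functions on $\Pi V$, where $x_1,\dots,x_l$ (odd) and $y_1,\dots,y_n$ (even) form the basis of $\Pi V^*$ dual to chosen bases of $V_0$ and $V_1$. Write $\hat S_{\ge p}\Pi V^*$ for the functions all of whose monomials have length at least $p$, $\mathrm{Der}_{\ge p}$ for the superderivations of $\hat S\Pi V^*$ that map $\Pi V^*$ into $\hat S_{\ge p}\Pi V^*$, and $D$ for the odd linear vector field induced by $d$. For a homogeneous vector field $\xi$ put $\nabla\xi=\sum_z(-1)^{|\xi(z)||z|}\partial_z(\xi(z))$, the sum over all coordinates $z\in\{x_1,\dots,x_l,y_1,\dots,y_n\}$, with left partial derivatives. Let $\mathfrak g[\Pi V]=\mathrm{Der}_{\ge 2}\ltimes\Pi\hat S_{\ge 1}\Pi V^*$ be the pronilpotent differential graded Lie algebra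 with bracket $$[(\xi,\Pi f),(\eta,\Pi g)]=\bigl([\xi,\eta],\ \Pi(\xi(g)-(-1)^{ij}\eta(f))\bigr)$$ on elements of parities $i,j$ (where $\Pi f$ has parity $|f|+1$) and differential $$\partial(\xi,\Pi f)=\bigl([D,\xi],\ \Pi(D(f)-(-1)^{i}\tfrac12\nabla\xi)\bigr)$$ on elements of parity $i$. A unimodular $L_\infty$ structure on $V$ is a Maurer–Cartan element of $\mathfrak g[\Pi V]$, that is, a pair $(m,f)$ of an odd $m\in\mathrm{Der}_{\ge 2}$ and an even $f\in\hat S_{\ge1}\Pi V^*$ with $$[D,m]+\tfrac12[m,m]=0,\qquad D(f)+\tfrac12\nabla m+m(f)=0.$$ It is strictly unimodular if $f=0$. Two such structures $x,x'$ are equivalent if they are gauge equivalent in $\mathfrak g[\Pi V]$: there is an even $y\in\mathfrak g[\Pi V]$ with $$x'=x+\sum_{r\ge1}\tfrac1{r!}\,\mathrm{ad}(y)^{r-1}\bigl(\mathrm{ad}(y)x-\partial y\bigr),$$ the series converging for the filtration $F_p=\mathrm{Der}_{\ge p+1}\ltimes\Pi\hat S_{\ge p}\Pi V^*$. Theorem.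 Let $(m,f)$ be a unimodular $L_\infty$ structure on $V$. 1. If $n>0$ or $l$ is odd, then $(m,f)$ is equivalent to a strictly unimodular $L_\infty$ structure $(m',0)$ on $V$. 2. If $n=0$ and $l$ is even, then $(m,f)$ is equivalent to a unimodular $L_\infty$ structure of the form $(m',c\cdot x_1\cdots x_l)$, where $c\in\mathbf k$ and $(m',0)$ is itself a (strictly) unimodular $L_\infty$ structure on $V$. -/

import Mathlib

/-! Throughout, `k` is a field of characteristic zero and `V = V₀ ⊕ V₁` is a super vector space with
even part `V₀` of dimension `l` and odd part `V₁` of dimension `n`. Bases of `V₀` and `V₁` give dual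
coordinates on `ΠV`: odd coordinates `x_1, …, x_l` (dual to the basis of `V₀`) and even coordinates
`y_1, …, y_n` (dual to the basis of `V₁`). -/

namespace UnimodularLInfty

noncomputable section

/-- The exterior algebra `Λ(x_1, …, x_l)`. -/
abbrev Ext (k : Type*) [Field k] (l : ℕ) : Type _ := ExteriorAlgebra k (Fin l → k)

/-- The algebra `Ŝ(ΠV*) = k[[y_1, …, y_n]] ⊗ Λ(x_1, …, x_l)` of formal functions on `ΠV`, as power
series in the commuting variables `y_j` with coefficients in the exterior algebra on the `x_i`. -/
abbrev FormalFun (k : Type*) [Field k] (l n : ℕ) : Type _ := MvPowerSeries (Fin n) (Ext k l)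

section Functions

variable {k : Type*} [Field k] {l n : ℕ}

/-- The odd coordinate `x_i`. -/
def oddCoord (i : Fin l) : FormalFun k l n :=
  MvPowerSeries.C (ExteriorAlgebra.ι k (Pi.single i (1 : k)))

/-- The even coordinate `y_j`. -/
def evenCoord (j : Fin n) : FormalFun k l n := MvPowerSeries.X j

/-- The product `x_1 ⋯ x_l` of all the odd coordinates, in this order. -/
def topMonomial (k : Type*) [Field k] (l n : ℕ) : FormalFun k l n :=
  (List.ofFn fun i : Fin l => (oddCoord i : FormalFun k l n)).prod

/-- The sign `(-1)^i` of a parity `i`. -/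
def sgn (k : Type*) [Field k] (i : ZMod 2) : k := (-1) ^ i.val

/-- The formal functions of parity `i`; the `y_j` are even and the `x_i` are odd. -/
def parityPart (k : Type*) [Field k] (l n : ℕ) (i : ZMod 2) : Submodule k (FormalFun k l n) where
  carrier := {a | ∀ e : Fin n →₀ ℕ,
    MvPowerSeries.coeff e a ∈ CliffordAlgebra.evenOdd (0 : QuadraticForm k (Fin l → k)) i}
  add_mem' := fun ha hb e => by rw [map_add]; exact Submodule.add_mem _ (ha e) (hb e)
  zero_mem' := fun e => by rw [map_zero]; exact Submodule.zero_mem _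
  smul_mem' := fun c a ha e => Submodule.smul_mem _ c (ha e)

/-- `Ŝ_{≥ p}(ΠV*)`: the formal functions all of whose monomials (in the `x_i` and `y_j` together)
have length at least `p`. -/
def lengthGE (k : Type*) [Field k] (l n : ℕ) (p : ℕ) : Submodule k (FormalFun k l n) where
  carrier := {a | ∀ e : Fin n →₀ ℕ,
    MvPowerSeries.coeff e a ∈ ⨆ r : {r : ℕ // p ≤ e.degree + r}, ⋀[k]^(r : ℕ) (Fin l → k)}
  add_mem' := fun ha hb e => by rw [map_add]; exact Submodule.add_mem _ (ha e) (hb e)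
  zero_mem' := fun e => by rw [map_zero]; exact Submodule.zero_mem _
  smul_mem' := fun c a ha e => Submodule.smul_mem _ c (ha e)

/-- The partial derivative `∂/∂y_j`. -/
def partialEven (j : Fin n) : Module.End k (FormalFun k l n) where
  toFun a := fun e => ((e j : k) + 1) • MvPowerSeries.coeff (e + Finsupp.single j 1) a
  map_add' a b := by
    ext e
    change ((e j : k) + 1) • MvPowerSeries.coeff (e + Finsupp.single j 1) (a + b) = _
    rw [map_add, smul_add]; rfl
  map_smul' c a := by
    ext e
    exact smul_comm ((e j : k) + 1) c (MvPowerSeries.coeff (e + Finsupp.single j 1) a)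

/-- The (left) partial derivative `∂/∂x_i`: the odd derivation with `∂x_i/∂x_i = 1` that kills the
other coordinates, given on each coefficient by contraction with the `i`-th coordinate form. -/
def partialOdd (i : Fin l) : Module.End k (FormalFun k l n) where
  toFun a := fun e => CliffordAlgebra.contractLeft (Q := (0 : QuadraticForm k (Fin l → k)))
    (LinearMap.proj i : Module.Dual k (Fin l → k)) (MvPowerSeries.coeff e a)
  map_add' a b := by
    ext e
    exact map_add (CliffordAlgebra.contractLeft (Q := (0 : QuadraticForm k (Fin l → k)))
      (LinearMap.proj i : Module.Dual k (Fin l → k))) _ _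
  map_smul' c a := by
    ext e
    exact map_smul (CliffordAlgebra.contractLeft (Q := (0 : QuadraticForm k (Fin l → k)))
      (LinearMap.proj i : Module.Dual k (Fin l → k))) c _

/-- `IsVectorField i p ξ`: `ξ` is an element of parity `i` of `Der_{≥ p}(Ŝ ΠV*)`, that is, a
superderivation of parity `i` of the algebra of formal functions which sends the coordinates to
functions in `Ŝ_{≥ p}(ΠV*)`. (Continuity is automatic: by the Leibniz rule a superderivation maps
`Ŝ_{≥ q+1}` to `Ŝ_{≥ q}`, as there are finitely many coordinates.) -/
structure IsVectorField (i : ZMod 2) (p : ℕ) (ξ : Module.End k (FormalFun k l n)) : Prop where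
  map_parity : ∀ j, ∀ a ∈ parityPart k l n j, ξ a ∈ parityPart k l n (i + j)
  leibniz : ∀ j, ∀ a ∈ parityPart k l n j, ∀ b, ξ (a * b) = ξ a * b + sgn k (i * j) • (a * ξ b)
  map_evenCoord : ∀ j, ξ (evenCoord j) ∈ lengthGE k l n p
  map_oddCoord : ∀ j, ξ (oddCoord j) ∈ lengthGE k l n p

/-- The supercommutator `[ξ, η] = ξη - (-1)^{ij} ηξ` of operators `ξ, η` of parities `i, j`. -/
def superBracket (i j : ZMod 2) (ξ η : Module.End k (FormalFun k l n)) :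
    Module.End k (FormalFun k l n) :=
  ξ * η - sgn k (i * j) • (η * ξ)

/-- The divergence `∇ξ = ∑_z (-1)^{|ξ(z)||z|} ∂_z (ξ(z))`, the sum over all the coordinates `z`, of a
vector field `ξ = ∑_z ξ(z) ∂_z` of parity `i`. For an odd coordinate `z` the sign is
`(-1)^{i + 1}`. -/
def divergence (i : ZMod 2) (ξ : Module.End k (FormalFun k l n)) : FormalFun k l n :=
  ∑ j : Fin n, partialEven j (ξ (evenCoord j)) +
    sgn k (i + 1) • ∑ j : Fin l, partialOdd j (ξ (oddCoord j))

end Functions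

section Differential

variable {k : Type*} [Field k] {V₀ V₁ : Type*} [AddCommGroup V₀] [Module k V₀]
  [AddCommGroup V₁] [Module k V₁] {l n : ℕ}

/-- The linear odd vector field on `ΠV` induced by the odd operator `d = (d₀, d₁)` on `V = V₀ ⊕ V₁`:
it sends a linear coordinate `z` to the linear function `z ∘ d`. -/
def linearField (b₀ : Module.Basis (Fin l) k V₀) (b₁ : Module.Basis (Fin n) k V₁)
    (d₀ : V₀ →ₗ[k] V₁) (d₁ : V₁ →ₗ[k] V₀) : Module.End k (FormalFun k l n) :=
  ∑ j : Fin n,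
      LinearMap.mulLeft k (∑ i : Fin l, b₁.coord j (d₀ (b₀ i)) • (oddCoord i : FormalFun k l n)) *
        partialEven j +
    ∑ i : Fin l,
      LinearMap.mulLeft k (∑ j : Fin n, b₀.coord i (d₁ (b₁ j)) • (evenCoord j : FormalFun k l n)) *
        partialOdd i

end Differential

section DGLA

variable {k : Type*} [Field k] {l n : ℕ}

/-- Underlying pairs `(ξ, Πf)` of the differential graded Lie algebra
`𝔤[ΠV] = Der_{≥ 2}(Ŝ ΠV*) ⋉ Π Ŝ_{≥ 1}(ΠV*)`. -/
abbrev Pair (k : Type*) [Field k] (l n : ℕ) : Type _ :=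
  Module.End k (FormalFun k l n) × FormalFun k l n

/-- `F_p 𝔤[ΠV] = Der_{≥ p+1} ⋉ Π Ŝ_{≥ p}` in parity `i`. An element `Πf` has parity `|f| + 1`.
The elements of `𝔤[ΠV]` of parity `i` are those of `F_1`. -/
def MemFiltration (i : ZMod 2) (p : ℕ) (y : Pair k l n) : Prop :=
  IsVectorField i (p + 1) y.1 ∧ y.2 ∈ parityPart k l n (i + 1) ∧ y.2 ∈ lengthGE k l n p

/-- The Lie bracket of `𝔤[ΠV]`, on elements of parities `i` and `j`:
`[(ξ, Πf), (η, Πg)] = ([ξ, η], Π(ξ(g) - (-1)^{ij} η(f)))`. -/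
def bracket (i j : ZMod 2) (y z : Pair k l n) : Pair k l n :=
  (superBracket i j y.1 z.1, y.1 z.2 - sgn k (i * j) • z.1 y.2)

/-- The total differential of `𝔤[ΠV]` on elements of parity `i`, where `D` is the linear vector field
of the differential of `V`: `(ξ, Πf) ↦ ([D, ξ], Π(D(f) - (-1)^i ½ ∇ξ))`. -/
def differential (D : Module.End k (FormalFun k l n)) (i : ZMod 2) (y : Pair k l n) : Pair k l n :=
  (superBracket 1 i D y.1, D y.2 - sgn k i • (2⁻¹ : k) • divergence i y.1)

/-- `(m, f)` is a unimodular `L_∞` structure on `V`: `m` is an odd element of `Der_{≥ 2}(Ŝ ΠV*)`, `f`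
is an even element of `Ŝ_{≥ 1}(ΠV*)`, and `d(m) + ½[m, m] = 0`, `d(f) + ½ ∇m + m(f) = 0`.
These are the Maurer--Cartan elements of `𝔤[ΠV]`, see `isUnimodular_iff`. -/
structure IsUnimodular (D : Module.End k (FormalFun k l n)) (m : Module.End k (FormalFun k l n))
    (f : FormalFun k l n) : Prop where
  isVectorField : IsVectorField 1 2 m
  even : f ∈ parityPart k l n 0
  lengthGE_one : f ∈ lengthGE k l n 1
  mc_field : superBracket 1 1 D m + (2⁻¹ : k) • superBracket 1 1 m m = 0
  mc_function : D f + (2⁻¹ : k) • divergence 1 m + m f = 0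

theorem isUnimodular_iff [CharZero k] (D m : Module.End k (FormalFun k l n)) (f : FormalFun k l n) :
    IsUnimodular D m f ↔ MemFiltration 1 1 (m, f) ∧
      differential D 1 (m, f) + (2⁻¹ : k) • bracket 1 1 (m, f) (m, f) = 0 := by
  have hs : sgn k (1 : ZMod 2) = -1 := by
    rw [sgn, show (1 : ZMod 2).val = 1 from rfl, pow_one]
  have h2 : (2⁻¹ : k) • (m f - sgn k (1 * 1) • m f) = m f := by
    rw [mul_one, hs, neg_one_smul, sub_neg_eq_add, ← two_smul k, smul_smul,
      inv_mul_cancel₀ two_ne_zero, one_smul]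
  have h3 : differential D 1 (m, f) + (2⁻¹ : k) • bracket 1 1 (m, f) (m, f) =
      (superBracket 1 1 D m + (2⁻¹ : k) • superBracket 1 1 m m,
        D f + (2⁻¹ : k) • divergence 1 m + m f) := by
    refine Prod.ext rfl ?_
    change D f - sgn k 1 • (2⁻¹ : k) • divergence 1 m +
      (2⁻¹ : k) • (m f - sgn k (1 * 1) • m f) = _
    rw [h2, hs, neg_one_smul, sub_neg_eq_add]
  rw [h3, Prod.mk_eq_zero]
  exact ⟨fun h => ⟨⟨h.1, h.2, h.3⟩, h.4, h.5⟩, fun h => ⟨h.1.1, h.1.2.1, h.1.2.2, h.2.1, h.2.2⟩⟩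

/-- The `N`-th partial sum `x + ∑_{1 ≤ r ≤ N} (1/r!) ad(y)^{r-1} (ad(y) x - dy)` of the gauge action
`e^y · x`, for `y` even and `x` odd. -/
def gaugePartialSum (D : Module.End k (FormalFun k l n)) (y x : Pair k l n) (N : ℕ) : Pair k l n :=
  x + ∑ r ∈ Finset.range N, ((r + 1).factorial : k)⁻¹ •
    (bracket 0 1 y)^[r] (bracket 0 1 y x - differential D 0 y)

/-- `x` and `x'` are gauge equivalent in the pronilpotent dgla `𝔤[ΠV]`: there is an even element `y`
of `𝔤[ΠV]` with `e^y · x = x'`, the series converging with respect to the filtration `F_p`. -/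
def GaugeEquiv (D : Module.End k (FormalFun k l n)) (x x' : Pair k l n) : Prop :=
  ∃ y : Pair k l n, MemFiltration 0 1 y ∧
    ∀ p : ℕ, ∀ᶠ N in Filter.atTop, MemFiltration 1 p (x' - gaugePartialSum D y x N)

end DGLA

end

end UnimodularLInfty

/-! Put Q = D + m. As D² = 0 and ∇D = 0, the structure equations read Q² = 0 and Q f + ½∇Q = 0.
Acting by (ξ, 0), with ξ an even field in Der_{≥ 2}, replaces Q by e^ξ Q e^{-ξ} and f by f' = e^ξ f
+ ½ ((e^ξ - 1)/ξ) ∇ξ. Both equations survive (`IsUnimodular.gauge`), the second because the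
divergence is a cocycle (`divergence_superBracket`). It remains to see which f' can be reached.

To leading order in length, f' depends on ξ through ½∇ξ alone (`gaugeFunSum_sub_mem`). So let s be a
linear map from functions to fields that raises length by one and satisfies ∇(s u) = u - τ u. A
contraction argument then finds ξ = s u with f' in the image of τ (`exists_gaugeFunSum_eq`). If
there is an even coordinate y, the field (∫ u dy) ∂_y gives τ = 0. The odd coordinates give τ = ∏
x_i ∂_i (`exists_odd_section`), which for n = 0 sends every function to a multiple of x_1 ⋯ x_l. For
odd l that multiple is odd while f' is even, so it vanishes. For even l it may stay, but D = 0 and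
m' raises length, hence kills the top monomial, and (m', 0) is again a solution.

Convergence is controlled by length: the coefficient of y^e vanishes once the length exceeds |e| +
l. Series are therefore finite in each coefficient, and identities are checked modulo every length.
-/

namespace UnimodularLInfty

noncomputable section

/-! ### Parity signs -/

section Signs

variable {k : Type*} [Field k]

theorem sgn_zero : sgn k 0 = 1 := by simp [sgn]

theorem sgn_one : sgn k 1 = -1 := by
  rw [sgn, show (1 : ZMod 2).val = 1 from rfl, pow_one]

theorem sgn_add (i j : ZMod 2) : sgn k (i + j) = sgn k i * sgn k j := by
  have h : ∀ i : ZMod 2, i = 0 ∨ i = 1 := by decide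
  rcases h i with rfl | rfl <;> rcases h j with rfl | rfl
  · simp [sgn_zero]
  · simp [sgn_zero]
  · simp [sgn_zero]
  · rw [show (1 + 1 : ZMod 2) = 0 from rfl, sgn_zero, sgn_one]; ring

theorem sgn_mul_self (i : ZMod 2) : sgn k i * sgn k i = 1 := by
  rw [← sgn_add, show i + i = 0 by revert i; decide, sgn_zero]

end Signs

/-! ### The exterior algebra: parity, contraction, length -/

section Exterior

variable {k : Type*} [Field k] {l : ℕ}

/-- The part of parity `i` of the exterior algebra. -/
abbrev extParity (k : Type*) [Field k] (l : ℕ) (i : ZMod 2) : Submodule k (Ext k l) :=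
  CliffordAlgebra.evenOdd (0 : QuadraticForm k (Fin l → k)) i

/-- The sum of the exterior powers of degree `r` with `p ≤ d + r`. -/
abbrev extGE (k : Type*) [Field k] (l d p : ℕ) : Submodule k (Ext k l) :=
  ⨆ r : {r : ℕ // p ≤ d + r}, ⋀[k]^(r : ℕ) (Fin l → k)

theorem extParity_mul {i j : ZMod 2} {a b : Ext k l} (ha : a ∈ extParity k l i)
    (hb : b ∈ extParity k l j) : a * b ∈ extParity k l (i + j) :=
  CliffordAlgebra.evenOdd_mul_le _ _ _ (Submodule.mul_mem_mul ha hb)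

theorem ι_mem_extParity (v : Fin l → k) : ExteriorAlgebra.ι k v ∈ extParity k l 1 :=
  CliffordAlgebra.ι_mem_evenOdd_one _ v

theorem one_mem_extParity : (1 : Ext k l) ∈ extParity k l 0 :=
  Submodule.one_le.mp (CliffordAlgebra.one_le_evenOdd_zero _)

/-- Each parity part is spanned by products of generators, so a sign rule need only be checked on
scalars and carried through left multiplication by one generator. The predicate takes the parity as
an argument because it flips at each such step. -/
theorem extParity_induction {P : ZMod 2 → Ext k l → Prop} (h0 : ∀ j, P j 0)
    (h1 : ∀ c, P 0 (algebraMap k _ c)) (ha : ∀ j x y, P j x → P j y → P j (x + y))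
    (hm : ∀ v j x, x ∈ extParity k l j → P j x → P (1 + j) (ExteriorAlgebra.ι k v * x))
    {j : ZMod 2} {x : Ext k l} (hx : x ∈ extParity k l j) : P j x := by
  refine Submodule.iSup_induction _ (motive := P j) hx ?_ (h0 j) (ha j)
  rintro ⟨r, rfl⟩ x hx
  dsimp only at hx ⊢
  refine Submodule.pow_induction_on_left' _
    (C := fun r x _ => P (r : ZMod 2) x) (fun c => ?_) (fun x y i _ _ hx hy => ha _ _ _ hx hy) ?_ hx
  · simpa using h1 c
  · rintro _ ⟨v, rfl⟩ i x hx h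
    rw [Nat.succ_eq_add_one, Nat.cast_add, Nat.cast_one, add_comm]
    exact hm v _ x (Submodule.mem_iSup_of_mem ⟨i, rfl⟩ hx) h

theorem ι_mul_comm {j : ZMod 2} {b : Ext k l} (hb : b ∈ extParity k l j) (v : Fin l → k) :
    ExteriorAlgebra.ι k v * b = sgn k j • (b * ExteriorAlgebra.ι k v) := by
  refine extParity_induction (P := fun j b => ExteriorAlgebra.ι k v * b =
    sgn k j • (b * ExteriorAlgebra.ι k v)) (fun j => by simp) (fun c => ?_) ?_ ?_ hb
  · rw [sgn_zero, one_smul, Algebra.commutes]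
  · intro j x y hx hy
    rw [mul_add, add_mul, hx, hy, smul_add]
  · intro w j x _ hx
    rw [sgn_add, sgn_one, ← mul_assoc, eq_neg_of_add_eq_zero_left (ExteriorAlgebra.ι_add_mul_swap v w),
      neg_mul, mul_assoc, hx, mul_smul_comm, neg_one_mul, neg_smul, mul_assoc]

theorem extParity_supercomm {i j : ZMod 2} {a b : Ext k l} (ha : a ∈ extParity k l i)
    (hb : b ∈ extParity k l j) : a * b = sgn k (i * j) • (b * a) := by
  refine extParity_induction (P := fun i a => a * b = sgn k (i * j) • (b * a))
    (fun j => by simp) (fun c => ?_) ?_ ?_ ha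
  · rw [zero_mul, sgn_zero, one_smul, Algebra.commutes]
  · intro i x y hx hy
    rw [mul_add, add_mul, hx, hy, smul_add]
  · intro w i x _ hx
    rw [mul_assoc, hx, add_mul, one_mul, sgn_add, mul_smul_comm, ← mul_assoc, ι_mul_comm hb w,
      smul_mul_assoc, smul_smul, mul_assoc, mul_comm (sgn k j)]

/-- Contraction with the `i`-th coordinate form. -/
abbrev extContract (i : Fin l) : Ext k l →ₗ[k] Ext k l :=
  CliffordAlgebra.contractLeft (Q := (0 : QuadraticForm k (Fin l → k)))
    (LinearMap.proj i : Module.Dual k (Fin l → k))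

theorem extContract_ι_mul (i : Fin l) (v : Fin l → k) (b : Ext k l) :
    extContract i (ExteriorAlgebra.ι k v * b) = v i • b - ExteriorAlgebra.ι k v * extContract i b :=
  CliffordAlgebra.contractLeft_ι_mul _ _ _

theorem extContract_algebraMap (i : Fin l) (c : k) : extContract i (algebraMap k (Ext k l) c) = 0 :=
  CliffordAlgebra.contractLeft_algebraMap _ _ _

theorem extContract_mem (t : Fin l) {i : ZMod 2} {a : Ext k l} (ha : a ∈ extParity k l i) :
    extContract t a ∈ extParity k l (1 + i) := by
  refine extParity_induction (P := fun i a => extContract t a ∈ extParity k l (1 + i))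
    (fun j => by simp) (fun c => ?_) ?_ ?_ ha
  · rw [extContract_algebraMap]; exact Submodule.zero_mem _
  · intro i x y hx hy
    rw [map_add]; exact Submodule.add_mem _ hx hy
  · intro w i x hx h
    rw [extContract_ι_mul]
    refine Submodule.sub_mem _ (Submodule.smul_mem _ _ ?_) (extParity_mul (ι_mem_extParity w) h)
    rwa [← add_assoc, show (1 + 1 : ZMod 2) = 0 from rfl, zero_add]

theorem extContract_mul (t : Fin l) {i : ZMod 2} {a : Ext k l} (ha : a ∈ extParity k l i)
    (b : Ext k l) :
    extContract t (a * b) = extContract t a * b + sgn k i • (a * extContract t b) := by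
  refine extParity_induction (P := fun i a => extContract t (a * b) =
    extContract t a * b + sgn k i • (a * extContract t b)) (fun j => by simp) (fun c => ?_) ?_ ?_ ha
  · rw [extContract_algebraMap, ← Algebra.smul_def, map_smul, sgn_zero, one_smul, zero_mul, zero_add,
      Algebra.smul_def]
  · intro i x y hx hy
    rw [add_mul, map_add, hx, hy, map_add, add_mul, add_mul, smul_add]; abel
  · intro w i x hx h
    rw [mul_assoc, extContract_ι_mul, h, extContract_ι_mul, sgn_add, sgn_one, mul_add, sub_mul,
      mul_smul_comm, neg_one_mul, neg_smul, mul_assoc, mul_assoc, smul_mul_assoc]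
    abel

theorem extGE_mul {d d' p q : ℕ} {a b : Ext k l} (ha : a ∈ extGE k l d p)
    (hb : b ∈ extGE k l d' q) : a * b ∈ extGE k l (d + d') (p + q) := by
  refine Submodule.iSup_induction _ (motive := fun a => a * b ∈ extGE k l (d + d') (p + q)) ha
    ?_ (by simp) (fun x y hx hy => by rw [add_mul]; exact Submodule.add_mem _ hx hy)
  rintro ⟨r, hr⟩ x hx
  refine Submodule.iSup_induction _ (motive := fun b => x * b ∈ extGE k l (d + d') (p + q)) hb
    ?_ (by simp) (fun x y hx hy => by rw [mul_add]; exact Submodule.add_mem _ hx hy)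
  rintro ⟨s, hs⟩ y hy
  refine Submodule.mem_iSup_of_mem ⟨r + s, by omega⟩ ?_
  dsimp only at hx hy ⊢
  exact SetLike.mul_mem_graded hx hy

theorem ι_mem_extGE (v : Fin l → k) {d p : ℕ} (h : p ≤ d + 1) :
    ExteriorAlgebra.ι k v ∈ extGE k l d p := by
  refine Submodule.mem_iSup_of_mem ⟨1, h⟩ ?_
  simp

theorem one_mem_extGE {d p : ℕ} (h : p ≤ d) : (1 : Ext k l) ∈ extGE k l d p := by
  refine Submodule.mem_iSup_of_mem ⟨0, h⟩ ?_
  simp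

theorem extGE_mono {d d' p p' : ℕ} (h : p' + d ≤ p + d') : extGE k l d p ≤ extGE k l d' p' :=
  iSup_le fun r => le_iSup (fun r : {r : ℕ // p' ≤ d' + r} => ⋀[k]^(r : ℕ) (Fin l → k))
    ⟨r, by have := r.2; omega⟩

theorem extGE_eq_top {d p : ℕ} (h : p ≤ d) : extGE k l d p = ⊤ := by
  refine eq_top_iff.mpr ?_
  rw [← CliffordAlgebra.iSup_ι_range_eq_top (0 : QuadraticForm k (Fin l → k))]
  exact iSup_le fun r => le_iSup (fun r : {r : ℕ // p ≤ d + r} => ⋀[k]^(r : ℕ) (Fin l → k))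
    ⟨r, by omega⟩

theorem exteriorPower_eq_bot {r : ℕ} (h : l < r) : (⋀[k]^r (Fin l → k)) = ⊥ := by
  rw [← ExteriorAlgebra.ιMulti_span_fixedDegree, Submodule.span_eq_bot]
  rintro _ ⟨v, rfl⟩
  refine AlternatingMap.map_linearDependent _ _ fun hv => ?_
  have := hv.fintype_card_le_finrank
  simp at this
  omega

/-- This vanishing makes the length filtration separated and every series below finite in each
coefficient. -/
theorem extGE_eq_bot {d p : ℕ} (h : d + l < p) : extGE k l d p = ⊥ :=
  iSup_eq_bot.mpr fun r => exteriorPower_eq_bot (by have := r.2; omega)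

theorem extGE_succ_le {p : ℕ} : extGE k l 0 (p + 1) ≤
    Submodule.span k {c | ∃ i : Fin l, ∃ b ∈ extGE k l 0 p,
      c = ExteriorAlgebra.ι k (Pi.single i (1 : k)) * b} := by
  refine iSup_le ?_
  rintro ⟨r, hr⟩
  obtain ⟨r, rfl⟩ : ∃ s, r = s + 1 := ⟨r - 1, by omega⟩
  dsimp only
  change LinearMap.range (ExteriorAlgebra.ι k (M := Fin l → k)) ^ (r + 1) ≤ _
  rw [pow_succ', Submodule.mul_le]
  rintro _ ⟨v, rfl⟩ b hb
  have hb' : b ∈ extGE k l 0 p := Submodule.mem_iSup_of_mem ⟨r, by omega⟩ hb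
  rw [show v = ∑ i, v i • Pi.single i (1 : k) from pi_eq_sum_univ' v, map_sum, Finset.sum_mul]
  refine Submodule.sum_mem _ fun i _ => ?_
  rw [map_smul, smul_mul_assoc]
  exact Submodule.smul_mem _ _ (Submodule.subset_span ⟨i, b, hb', rfl⟩)

theorem ext_le_span : (⊤ : Submodule k (Ext k l)) ≤
    Submodule.span k {1} ⊔ extGE k l 0 1 := by
  rw [← CliffordAlgebra.iSup_ι_range_eq_top (0 : QuadraticForm k (Fin l → k))]
  refine iSup_le fun r => ?_
  rcases r with _ | r
  · rw [pow_zero, Submodule.one_eq_span]; exact le_sup_left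
  · exact le_sup_of_le_right (le_iSup (fun r : {r : ℕ // 1 ≤ 0 + r} => ⋀[k]^(r : ℕ) (Fin l → k))
      ⟨r + 1, by omega⟩)

end Exterior

/-! ### Formal functions: length filtration and partial derivatives -/

section Series

variable {k : Type*} [Field k] {l n : ℕ}

theorem coeff_smul_field (e : Fin n →₀ ℕ) (c : k) (a : FormalFun k l n) :
    MvPowerSeries.coeff e (c • a) = c • MvPowerSeries.coeff e a := rfl

theorem coeff_X_mul_add (j : Fin n) (e : Fin n →₀ ℕ) (a : FormalFun k l n) :
    MvPowerSeries.coeff (e + Finsupp.single j 1) (evenCoord j * a) = MvPowerSeries.coeff e a := by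
  rw [evenCoord, MvPowerSeries.X_def, add_comm, MvPowerSeries.coeff_add_monomial_mul, one_mul]

theorem coeff_X_mul_of_eq_zero {j : Fin n} {e : Fin n →₀ ℕ} (h : e j = 0) (a : FormalFun k l n) :
    MvPowerSeries.coeff e (evenCoord j * a) = 0 := by
  rw [evenCoord, MvPowerSeries.X_def, MvPowerSeries.coeff_monomial_mul, if_neg]
  intro hle
  have := hle j
  simp [h] at this

theorem exists_add_single {j : Fin n} {e : Fin n →₀ ℕ} (h : e j ≠ 0) :
    ∃ e' : Fin n →₀ ℕ, e = e' + Finsupp.single j 1 :=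
  ⟨e - Finsupp.single j 1, by
    rw [tsub_add_cancel_of_le]
    rw [Finsupp.single_le_iff]; omega⟩

theorem parityPart_mul {i j : ZMod 2} {a b : FormalFun k l n} (ha : a ∈ parityPart k l n i)
    (hb : b ∈ parityPart k l n j) : a * b ∈ parityPart k l n (i + j) := fun e => by
  classical
  rw [MvPowerSeries.coeff_mul]
  exact Submodule.sum_mem _ fun p _ => extParity_mul (ha p.1) (hb p.2)

theorem lengthGE_mul {p q : ℕ} {a b : FormalFun k l n} (ha : a ∈ lengthGE k l n p)
    (hb : b ∈ lengthGE k l n q) : a * b ∈ lengthGE k l n (p + q) := fun e => by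
  classical
  rw [MvPowerSeries.coeff_mul]
  refine Submodule.sum_mem _ fun x hx => ?_
  rw [Finset.HasAntidiagonal.mem_antidiagonal] at hx
  have := extGE_mul (ha x.1) (hb x.2)
  rwa [← map_add, hx] at this

theorem supercomm {i j : ZMod 2} {a b : FormalFun k l n} (ha : a ∈ parityPart k l n i)
    (hb : b ∈ parityPart k l n j) : a * b = sgn k (i * j) • (b * a) := by
  classical
  ext e
  rw [coeff_smul_field, MvPowerSeries.coeff_mul, MvPowerSeries.coeff_mul, Finset.smul_sum]
  refine Finset.sum_nbij' Prod.swap Prod.swap ?_ ?_ (fun _ _ => rfl) (fun _ _ => rfl)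
    fun p _ => extParity_supercomm (ha _) (hb _)
  all_goals
    intro p hp
    rw [Finset.HasAntidiagonal.mem_antidiagonal] at hp ⊢
    rw [← hp, add_comm]; rfl

theorem lengthGE_mono {p q : ℕ} (h : q ≤ p) : lengthGE k l n p ≤ lengthGE k l n q :=
  fun _ ha e => extGE_mono (by omega) (ha e)

theorem lengthGE_zero : lengthGE k l n 0 = ⊤ :=
  eq_top_iff.mpr fun _ _ e => by
    change _ ∈ extGE k l e.degree 0
    rw [extGE_eq_top (Nat.zero_le _)]; trivial

theorem mem_lengthGE_zero (a : FormalFun k l n) : a ∈ lengthGE k l n 0 := by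
  rw [lengthGE_zero]; trivial

theorem coeff_eq_zero_of_mem_lengthGE {p : ℕ} {a : FormalFun k l n} (ha : a ∈ lengthGE k l n p)
    {e : Fin n →₀ ℕ} (h : e.degree + l < p) : MvPowerSeries.coeff e a = 0 := by
  have := ha e
  change _ ∈ extGE k l e.degree p at this
  rwa [extGE_eq_bot h, Submodule.mem_bot] at this

theorem eq_zero_of_forall_mem_lengthGE {a : FormalFun k l n} (h : ∀ p, a ∈ lengthGE k l n p) :
    a = 0 := by
  ext e
  rw [coeff_eq_zero_of_mem_lengthGE (h (e.degree + l + 1)) (Nat.lt_succ_self _), map_zero]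

theorem C_mem_parityPart {i : ZMod 2} {a : Ext k l} (ha : a ∈ extParity k l i) :
    (MvPowerSeries.C a : FormalFun k l n) ∈ parityPart k l n i := fun e => by
  classical
  rw [MvPowerSeries.coeff_C]
  split_ifs
  exacts [ha, Submodule.zero_mem _]

theorem one_mem_parityPart : (1 : FormalFun k l n) ∈ parityPart k l n 0 := by
  rw [← map_one MvPowerSeries.C]
  exact C_mem_parityPart one_mem_extParity

/-- The index type of the coordinates: the even ones on the left, the odd ones on the right. -/
abbrev CoordIdx (l n : ℕ) : Type := Fin n ⊕ Fin l

/-- The parity of a coordinate. -/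
def coordParity : CoordIdx l n → ZMod 2 := Sum.elim (fun _ => 0) fun _ => 1

/-- The coordinate functions. -/
def coord (k : Type*) [Field k] : CoordIdx l n → FormalFun k l n := Sum.elim evenCoord oddCoord

/-- The partial derivatives along the coordinates. -/
def partialCoord (k : Type*) [Field k] : CoordIdx l n → Module.End k (FormalFun k l n) :=
  Sum.elim partialEven partialOdd

theorem coord_mem_parityPart (z : CoordIdx l n) : coord k z ∈ parityPart k l n (coordParity z) := by
  classical
  rcases z with j | i
  · intro e
    change MvPowerSeries.coeff e (MvPowerSeries.X j) ∈ extParity k l 0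
    rw [MvPowerSeries.coeff_X]
    split_ifs
    exacts [one_mem_extParity, Submodule.zero_mem _]
  · exact C_mem_parityPart (ι_mem_extParity _)

theorem coord_mem_lengthGE (z : CoordIdx l n) : coord k z ∈ lengthGE k l n 1 := by
  classical
  rcases z with j | i
  · intro e
    change MvPowerSeries.coeff e (MvPowerSeries.X j) ∈ extGE k l e.degree 1
    rw [MvPowerSeries.coeff_X]
    split_ifs with h
    · exact one_mem_extGE (by rw [h]; simp)
    · exact Submodule.zero_mem _
  · intro e
    change MvPowerSeries.coeff e (MvPowerSeries.C _) ∈ extGE k l e.degree 1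
    rw [MvPowerSeries.coeff_C]
    split_ifs with h
    · exact ι_mem_extGE _ (by omega)
    · exact Submodule.zero_mem _

theorem coeff_partialEven (j : Fin n) (a : FormalFun k l n) (e : Fin n →₀ ℕ) :
    MvPowerSeries.coeff e (partialEven j a) =
      ((e j : k) + 1) • MvPowerSeries.coeff (e + Finsupp.single j 1) a := rfl

theorem coeff_partialOdd (i : Fin l) (a : FormalFun k l n) (e : Fin n →₀ ℕ) :
    MvPowerSeries.coeff e (partialOdd i a) = extContract i (MvPowerSeries.coeff e a) := rfl

theorem coeff_X_mul_partialEven (j : Fin n) (a : FormalFun k l n) (e : Fin n →₀ ℕ) :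
    MvPowerSeries.coeff e (evenCoord j * partialEven j a) =
      (e j : k) • MvPowerSeries.coeff e a := by
  by_cases h : e j = 0
  · rw [coeff_X_mul_of_eq_zero h, h, Nat.cast_zero, zero_smul]
  · obtain ⟨e, rfl⟩ := exists_add_single h
    rw [coeff_X_mul_add, coeff_partialEven]
    simp

/-- The operator y_j ∂_j is diagonal on monomials, with eigenvalue the exponent of y_j, and
exponents add under multiplication. The rule is therefore proved after multiplying by y_j, which
loses no coefficient. -/
theorem partialEven_mul (j : Fin n) (a b : FormalFun k l n) :
    partialEven j (a * b) = partialEven j a * b + a * partialEven j b := by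
  classical
  have key : (evenCoord j : FormalFun k l n) * partialEven j (a * b) =
      evenCoord j * (partialEven j a * b + a * partialEven j b) := by
    ext e
    have hc : (evenCoord j : FormalFun k l n) * (partialEven j a * b + a * partialEven j b) =
        (evenCoord j * partialEven j a) * b + a * (evenCoord j * partialEven j b) := by
      have hX : (evenCoord j : FormalFun k l n) * a = a * evenCoord j := MvPowerSeries.X_mul
      rw [mul_add, ← mul_assoc, ← mul_assoc, hX, mul_assoc a]
    rw [hc, coeff_X_mul_partialEven, map_add, MvPowerSeries.coeff_mul, MvPowerSeries.coeff_mul,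
      MvPowerSeries.coeff_mul, Finset.smul_sum, ← Finset.sum_add_distrib]
    refine Finset.sum_congr rfl fun p hp => ?_
    rw [Finset.HasAntidiagonal.mem_antidiagonal] at hp
    rw [coeff_X_mul_partialEven, coeff_X_mul_partialEven, ← hp, smul_mul_assoc, mul_smul_comm,
      ← add_smul, Finsupp.add_apply, Nat.cast_add]
  ext e
  rw [← coeff_X_mul_add j, key, coeff_X_mul_add]

theorem partialOdd_mul (t : Fin l) {i : ZMod 2} {a : FormalFun k l n}
    (ha : a ∈ parityPart k l n i) (b : FormalFun k l n) :
    partialOdd t (a * b) = partialOdd t a * b + sgn k i • (a * partialOdd t b) := by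
  classical
  ext e
  rw [coeff_partialOdd, map_add, coeff_smul_field, MvPowerSeries.coeff_mul, MvPowerSeries.coeff_mul,
    MvPowerSeries.coeff_mul, Finset.smul_sum, ← Finset.sum_add_distrib, map_sum]
  exact Finset.sum_congr rfl fun p _ => extContract_mul t (ha _) _

theorem isVectorField_partialCoord (z : CoordIdx l n) :
    IsVectorField (coordParity z) 0 (partialCoord k z) where
  map_parity i a ha e := by
    rcases z with j | t
    · change _ ∈ extParity k l (0 + i)
      rw [zero_add]
      exact Submodule.smul_mem _ _ (ha _)
    · exact extContract_mem t (ha e)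
  leibniz i a ha b := by
    rcases z with j | t
    · change partialEven j (a * b) = partialEven j a * b + sgn k (0 * i) • (a * partialEven j b)
      rw [zero_mul, sgn_zero, one_smul, partialEven_mul]
    · change partialOdd t (a * b) = partialOdd t a * b + sgn k (1 * i) • (a * partialOdd t b)
      rw [one_mul, partialOdd_mul t ha]
  map_evenCoord _ := mem_lengthGE_zero _
  map_oddCoord _ := mem_lengthGE_zero _

theorem partialCoord_coord (z w : CoordIdx l n) :
    partialCoord k z (coord k w) = if z = w then 1 else 0 := by
  classical
  rcases z with j | t <;> rcases w with j' | t'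
  · ext e
    change ((e j : k) + 1) • MvPowerSeries.coeff (e + Finsupp.single j 1) (MvPowerSeries.X (R := Ext k l) j') = _
    simp only [Sum.inl.injEq]
    rw [MvPowerSeries.coeff_X]
    by_cases h : j = j'
    · subst h
      rw [if_pos rfl, MvPowerSeries.coeff_one]
      by_cases he : e = 0
      · simp [he]
      · rw [if_neg (by simpa using he), if_neg he, smul_zero]
    · rw [if_neg h, if_neg, smul_zero, map_zero]
      intro h'
      have := DFunLike.congr_fun h' j
      simp [Ne.symm h] at this
  · ext e
    change ((e j : k) + 1) • MvPowerSeries.coeff (e + Finsupp.single j 1) (MvPowerSeries.C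
      (ExteriorAlgebra.ι k (Pi.single (M := fun _ => k) t' 1))) = _
    rw [MvPowerSeries.coeff_C, if_neg, smul_zero, if_neg (by simp), map_zero]
    intro h'
    have := DFunLike.congr_fun h' j
    simp at this
  · ext e
    change extContract t (MvPowerSeries.coeff e (MvPowerSeries.X j')) = _
    rw [MvPowerSeries.coeff_X, if_neg (by simp : ¬ (Sum.inr t : CoordIdx l n) = Sum.inl j'), map_zero]
    split_ifs
    · exact CliffordAlgebra.contractLeft_one (Q := (0 : QuadraticForm k (Fin l → k))) _
    · exact map_zero _
  · ext e
    change extContract t (MvPowerSeries.coeff e (MvPowerSeries.C _)) = _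
    simp only [Sum.inr.injEq]
    rw [MvPowerSeries.coeff_C]
    split_ifs with h1 h2 h2
    · subst h2
      rw [← mul_one (ExteriorAlgebra.ι k _), extContract_ι_mul, h1]
      simp [CliffordAlgebra.contractLeft_one]
    · rw [← mul_one (ExteriorAlgebra.ι k _), extContract_ι_mul, h1]
      simp [CliffordAlgebra.contractLeft_one, h2]
    · rw [map_zero, MvPowerSeries.coeff_one, if_neg h1]
    · rw [map_zero, map_zero]

/-- A formal function without constant coefficient in the `y_j` is a combination of the `y_j`. -/
theorem exists_sum_evenCoord_mul {p : ℕ} {a : FormalFun k l n} (ha : a ∈ lengthGE k l n (p + 1))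
    (h0 : MvPowerSeries.coeff 0 a = 0) :
    ∃ b : Fin n → FormalFun k l n, (∀ j, b j ∈ lengthGE k l n p) ∧
      a = ∑ j, evenCoord j * b j := by
  classical
  have hex : ∀ e : Fin n →₀ ℕ, e ≠ 0 → ∃ j, e j ≠ 0 := fun e he => by
    by_contra! h
    exact he (Finsupp.ext h)
  rcases isEmpty_or_nonempty (Fin n) with hn | hn
  · refine ⟨isEmptyElim, isEmptyElim, ?_⟩
    ext e
    rw [Subsingleton.elim e 0, h0]
    simp
  -- The choice `c e` is a variable that occurs in y^e. Assigning the monomial y^e to that variable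
  -- alone avoids counting it twice in the sum.
  choose! c hc using hex
  refine ⟨fun j => (fun e => if c (e + Finsupp.single j 1) = j then
    MvPowerSeries.coeff (e + Finsupp.single j 1) a else 0), fun j e => ?_, ?_⟩
  · change (if c (e + Finsupp.single j 1) = j then
      MvPowerSeries.coeff (e + Finsupp.single j 1) a else 0) ∈ extGE k l e.degree p
    split_ifs
    · exact extGE_mono (by rw [map_add, Finsupp.degree_single]; omega) (ha _)
    · exact Submodule.zero_mem _
  · ext e
    rw [map_sum]
    by_cases he : e = 0
    · subst he
      rw [h0, Finset.sum_eq_zero]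
      exact fun j _ => coeff_X_mul_of_eq_zero rfl _
    · rw [Finset.sum_eq_single (c e)]
      · obtain ⟨e', he'⟩ := exists_add_single (hc e he)
        generalize hj : c e = j at he' ⊢
        subst he'
        exact ((coeff_X_mul_add j e' _).trans (if_pos hj)).symm
      · intro j _ hj
        by_cases h : e j = 0
        · exact coeff_X_mul_of_eq_zero h _
        · obtain ⟨e', rfl⟩ := exists_add_single h
          exact (coeff_X_mul_add j e' _).trans (if_neg (Ne.symm hj))
      · simp

/-- As there are finitely many coordinates, an ordinary span suffices, without closure. This is why
superderivations are automatically continuous. -/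
theorem lengthGE_succ_le (p : ℕ) : lengthGE k l n (p + 1) ≤
    Submodule.span k {c | ∃ z : CoordIdx l n, ∃ b ∈ lengthGE k l n p, c = coord k z * b} := by
  classical
  intro a ha
  set S := Submodule.span k {c | ∃ z : CoordIdx l n, ∃ b ∈ lengthGE k l n p, c = coord k z * b}
  have hC : ∀ u ∈ extGE k l 0 (p + 1), (MvPowerSeries.C u : FormalFun k l n) ∈ S := by
    intro u hu
    have := extGE_succ_le hu
    refine Submodule.span_induction (p := fun u _ => (MvPowerSeries.C u : FormalFun k l n) ∈ S)
      ?_ (by simp) (fun x y _ _ hx hy => by rw [map_add]; exact Submodule.add_mem _ hx hy)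
      (fun c x _ hx => ?_) this
    · rintro _ ⟨i, b, hb, rfl⟩
      refine Submodule.subset_span ⟨Sum.inr i, MvPowerSeries.C b, fun e => ?_, ?_⟩
      · rw [MvPowerSeries.coeff_C]
        split_ifs with h
        · subst h; rw [map_zero]; exact hb
        · exact Submodule.zero_mem _
      · rw [map_mul]; rfl
    · have : (MvPowerSeries.C (c • x) : FormalFun k l n) = c • MvPowerSeries.C x := by
        ext e
        rw [coeff_smul_field, MvPowerSeries.coeff_C, MvPowerSeries.coeff_C]
        split_ifs <;> simp
      rw [this]
      exact Submodule.smul_mem _ _ hx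
  have h0 : MvPowerSeries.C (MvPowerSeries.coeff 0 a) ∈ lengthGE k l n (p + 1) := fun e => by
    rw [MvPowerSeries.coeff_C]
    split_ifs with h
    · subst h; exact ha 0
    · exact Submodule.zero_mem _
  obtain ⟨b, hb, hab⟩ := exists_sum_evenCoord_mul (Submodule.sub_mem _ ha h0)
    (by rw [map_sub, MvPowerSeries.coeff_zero_C, sub_self])
  rw [← sub_add_cancel a (MvPowerSeries.C (MvPowerSeries.coeff 0 a)), hab]
  refine Submodule.add_mem _ (Submodule.sum_mem _ fun j _ => ?_) (hC _ ?_)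
  · exact Submodule.subset_span ⟨Sum.inl j, b j, hb j, rfl⟩
  · exact extGE_mono (by simp) (ha 0)

theorem exists_sub_smul_one_mem (a : FormalFun k l n) :
    ∃ c : k, a - c • (1 : FormalFun k l n) ∈ lengthGE k l n 1 := by
  classical
  obtain ⟨x, hx, y, hy, hxy⟩ := Submodule.mem_sup.mp
    (ext_le_span (Submodule.mem_top : MvPowerSeries.coeff 0 a ∈ ⊤))
  obtain ⟨c, rfl⟩ := Submodule.mem_span_singleton.mp hx
  refine ⟨c, fun e => ?_⟩
  rw [map_sub, coeff_smul_field, MvPowerSeries.coeff_one]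
  change _ ∈ extGE k l _ _
  split_ifs with h
  · subst h
    rw [← hxy, add_sub_cancel_left]
    rw [map_zero]
    exact hy
  · rw [extGE_eq_top]
    · trivial
    · rw [Nat.one_le_iff_ne_zero]
      rwa [Ne, Finsupp.degree_eq_zero_iff]

end Series

/-! ### Vector fields, brackets and the divergence -/

section VectorFields

variable {k : Type*} [Field k] {l n : ℕ} {i j : ZMod 2} {p q : ℕ}
  {ξ η : Module.End k (FormalFun k l n)}

theorem IsVectorField.map_coord (h : IsVectorField i p ξ) (z : CoordIdx l n) :
    ξ (coord k z) ∈ lengthGE k l n p := by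
  rcases z with t | t
  exacts [h.map_evenCoord t, h.map_oddCoord t]

theorem IsVectorField.map_coord_parity (h : IsVectorField i p ξ) (z : CoordIdx l n) :
    ξ (coord k z) ∈ parityPart k l n (i + coordParity z) :=
  h.map_parity _ _ (coord_mem_parityPart z)

theorem IsVectorField.of_coord (h : IsVectorField i q ξ)
    (hc : ∀ z, ξ (coord k z) ∈ lengthGE k l n p) : IsVectorField i p ξ :=
  ⟨h.map_parity, h.leibniz, fun t => hc (Sum.inl t), fun t => hc (Sum.inr t)⟩

theorem IsVectorField.mono (h : IsVectorField i q ξ) (hpq : p ≤ q) : IsVectorField i p ξ :=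
  h.of_coord fun z => lengthGE_mono hpq (h.map_coord z)

theorem IsVectorField.map_one (h : IsVectorField i p ξ) : ξ 1 = 0 := by
  have := h.leibniz 0 1 one_mem_parityPart 1
  rw [mul_zero, sgn_zero, one_smul, mul_one, mul_one, one_mul] at this
  simpa using this

theorem isVectorField_zero : IsVectorField i p (0 : Module.End k (FormalFun k l n)) :=
  ⟨fun _ _ _ => Submodule.zero_mem _, fun _ _ _ _ => by simp, fun _ => Submodule.zero_mem _,
    fun _ => Submodule.zero_mem _⟩

theorem IsVectorField.add (h : IsVectorField i p ξ) (h' : IsVectorField i p η) :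
    IsVectorField i p (ξ + η) where
  map_parity t a ha := Submodule.add_mem _ (h.map_parity t a ha) (h'.map_parity t a ha)
  leibniz t a ha b := by
    simp only [LinearMap.add_apply]
    rw [h.leibniz t a ha b, h'.leibniz t a ha b, add_mul, mul_add, smul_add]; abel
  map_evenCoord t := Submodule.add_mem _ (h.map_evenCoord t) (h'.map_evenCoord t)
  map_oddCoord t := Submodule.add_mem _ (h.map_oddCoord t) (h'.map_oddCoord t)

theorem IsVectorField.smul (h : IsVectorField i p ξ) (c : k) : IsVectorField i p (c • ξ) where
  map_parity t a ha := Submodule.smul_mem _ _ (h.map_parity t a ha)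
  leibniz t a ha b := by
    simp only [LinearMap.smul_apply]
    rw [h.leibniz t a ha b, smul_add, smul_mul_assoc, mul_smul_comm, smul_comm c]
  map_evenCoord t := Submodule.smul_mem _ _ (h.map_evenCoord t)
  map_oddCoord t := Submodule.smul_mem _ _ (h.map_oddCoord t)

theorem IsVectorField.sub (h : IsVectorField i p ξ) (h' : IsVectorField i p η) :
    IsVectorField i p (ξ - η) := by
  rw [sub_eq_add_neg, ← neg_one_smul k η]
  exact h.add (h'.smul _)

theorem IsVectorField.sum {ι : Type*} (s : Finset ι) {ξ : ι → Module.End k (FormalFun k l n)}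
    (h : ∀ t ∈ s, IsVectorField i p (ξ t)) : IsVectorField i p (∑ t ∈ s, ξ t) :=
  Finset.sum_induction ξ (IsVectorField i p) (fun _ _ => IsVectorField.add) isVectorField_zero h

/-- An element of `Der_{≥ p}` maps `Ŝ_{≥ q}` to `Ŝ_{≥ q + p - 1}`. -/
theorem IsVectorField.map_lengthGE (h : IsVectorField i p ξ) {r : ℕ} (hr : r + 1 ≤ q + p)
    {a : FormalFun k l n} (ha : a ∈ lengthGE k l n q) : ξ a ∈ lengthGE k l n r := by
  induction r generalizing q a with
  | zero => exact mem_lengthGE_zero _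
  | succ r ih =>
    have pos : ∀ q a, r + 1 ≤ q + p → a ∈ lengthGE k l n (q + 1) →
        ξ a ∈ lengthGE k l n (r + 1) := by
      intro q a hq ha
      refine Submodule.span_induction (p := fun a _ => ξ a ∈ lengthGE k l n (r + 1)) ?_ (by simp)
        (fun x y _ _ hx hy => by rw [map_add]; exact Submodule.add_mem _ hx hy)
        (fun c x _ hx => by rw [map_smul]; exact Submodule.smul_mem _ _ hx) (lengthGE_succ_le _ ha)
      rintro _ ⟨z, b, hb, rfl⟩
      rw [h.leibniz _ _ (coord_mem_parityPart z)]
      refine Submodule.add_mem _ ?_ (Submodule.smul_mem _ _ ?_)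
      · exact lengthGE_mono (by omega) (lengthGE_mul (h.map_coord z) hb)
      · exact lengthGE_mono (by omega) (lengthGE_mul (coord_mem_lengthGE z) (ih hq hb))
    -- For q = 0 the constant term is subtracted first: the field kills it, and the rest has length
    -- at least 1.
    rcases q with _ | q
    · obtain ⟨c, hc⟩ := exists_sub_smul_one_mem a
      have := pos 0 _ (by omega) hc
      rwa [map_sub, map_smul, h.map_one, smul_zero, sub_zero] at this
    · exact pos q a (by omega) ha

/-- A field that kills the coordinates lies in Der_{≥ r + 1} for every r, so each of its values has
arbitrarily large length. -/
theorem IsVectorField.eq_zero (h : IsVectorField i p ξ) (h0 : ∀ z, ξ (coord k z) = 0) : ξ = 0 := by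
  refine LinearMap.ext fun a => eq_zero_of_forall_mem_lengthGE fun r => ?_
  have h' : IsVectorField i (r + 1) ξ := h.of_coord fun z => by
    rw [h0]; exact Submodule.zero_mem _
  exact h'.map_lengthGE (q := 0) (by omega) (mem_lengthGE_zero a)

theorem IsVectorField.ext (h : IsVectorField i p ξ) (h' : IsVectorField i q η)
    (he : ∀ z, ξ (coord k z) = η (coord k z)) : ξ = η := by
  rw [← sub_eq_zero]
  refine ((h.mono (Nat.zero_le _)).sub (h'.mono (Nat.zero_le _))).eq_zero fun z => ?_
  rw [LinearMap.sub_apply, he, sub_self]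

theorem superBracket_apply (a : FormalFun k l n) :
    superBracket i j ξ η a = ξ (η a) - sgn k (i * j) • η (ξ a) := rfl

theorem IsVectorField.superBracket (h : IsVectorField i p ξ) (h' : IsVectorField j q η) {r : ℕ}
    (hr : r + 1 ≤ p + q) : IsVectorField (i + j) r (superBracket i j ξ η) := by
  have key : ∀ z, UnimodularLInfty.superBracket i j ξ η (coord k z) ∈ lengthGE k l n r := fun z =>
    Submodule.sub_mem _ (h.map_lengthGE (by omega) (h'.map_coord z))
      (Submodule.smul_mem _ _ (h'.map_lengthGE (by omega) (h.map_coord z)))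
  refine ⟨fun t a ha => ?_, fun t a ha b => ?_, fun t => key (Sum.inl t), fun t => key (Sum.inr t)⟩
  · refine Submodule.sub_mem _ ?_ (Submodule.smul_mem _ _ ?_)
    · rw [add_assoc]
      exact h.map_parity _ _ (h'.map_parity _ _ ha)
    · rw [add_assoc, add_left_comm]
      exact h'.map_parity _ _ (h.map_parity _ _ ha)
  · simp only [superBracket_apply]
    rw [h'.leibniz t a ha, h.leibniz t a ha, map_add, map_add, map_smul, map_smul,
      h.leibniz _ _ (h'.map_parity _ _ ha), h.leibniz t a ha, h'.leibniz _ _ (h.map_parity _ _ ha),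
      h'.leibniz t a ha]
    simp only [mul_add, add_mul, sgn_add, sub_mul, mul_sub, smul_mul_assoc, mul_smul_comm]
    rw [mul_comm j i]
    have e := sgn_mul_self (k := k) (i * j)
    -- The coefficient of ξ a * η b is the one that needs the square of the sign to be 1.
    match_scalars <;> first | ring1 | linear_combination (-sgn k (j * t)) * e

theorem isVectorField_mulLeft_partialCoord {z : CoordIdx l n} {a : FormalFun k l n}
    (ha : a ∈ parityPart k l n (i + coordParity z)) (hp : a ∈ lengthGE k l n p) :
    IsVectorField i p (LinearMap.mulLeft k a * partialCoord k z) := by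
  have hz := isVectorField_partialCoord (k := k) z
  refine IsVectorField.of_coord (q := 0) ⟨fun t b hb => ?_, fun t b hb c => ?_,
    fun _ => mem_lengthGE_zero _, fun _ => mem_lengthGE_zero _⟩ fun w => ?_
  · have h := parityPart_mul ha (hz.map_parity _ _ hb)
    have e : ∀ i s t : ZMod 2, i + s + (s + t) = i + t := by decide
    rwa [e] at h
  · simp only [Module.End.mul_apply, LinearMap.mulLeft_apply]
    rw [hz.leibniz t b hb, mul_add, mul_smul_comm, ← mul_assoc a b, supercomm ha hb, ← mul_assoc,
      smul_mul_assoc, smul_smul, ← sgn_add, mul_assoc, mul_assoc]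
    have e : ∀ i s t : ZMod 2, s * t + (i + s) * t = i * t := by decide
    rw [e]
  · rw [Module.End.mul_apply, LinearMap.mulLeft_apply, partialCoord_coord]
    split_ifs
    · rwa [mul_one]
    · rw [mul_zero]; exact Submodule.zero_mem _

theorem IsVectorField.eq_sum (h : IsVectorField i p ξ) :
    ξ = ∑ z, LinearMap.mulLeft k (ξ (coord k z)) * partialCoord k z := by
  refine h.ext (IsVectorField.sum _ fun z _ =>
    isVectorField_mulLeft_partialCoord (h.map_coord_parity z) (h.map_coord z)) fun w => ?_
  simp only [LinearMap.sum_apply, Module.End.mul_apply, LinearMap.mulLeft_apply, partialCoord_coord]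
  simp

theorem IsVectorField.apply_eq_sum (h : IsVectorField i p ξ) (a : FormalFun k l n) :
    ξ a = ∑ z, ξ (coord k z) * partialCoord k z a := by
  conv_lhs => rw [h.eq_sum]
  simp only [LinearMap.sum_apply, Module.End.mul_apply, LinearMap.mulLeft_apply]

theorem divergence_eq_sum (i : ZMod 2) (ξ : Module.End k (FormalFun k l n)) :
    divergence i ξ = ∑ z : CoordIdx l n, sgn k ((i + coordParity z) * coordParity z) •
      partialCoord k z (ξ (coord k z)) := by
  rw [Fintype.sum_sum_type, divergence, Finset.smul_sum]
  congr 1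
  · refine Finset.sum_congr rfl fun t _ => ?_
    change _ = sgn k ((i + 0) * 0) • partialEven t (ξ (evenCoord t))
    rw [mul_zero, sgn_zero, one_smul]
  · refine Finset.sum_congr rfl fun t _ => ?_
    change _ = sgn k ((i + 1) * 1) • partialOdd t (ξ (oddCoord t))
    rw [mul_one]

theorem divergence_add (i : ZMod 2) (ξ η : Module.End k (FormalFun k l n)) :
    divergence i (ξ + η) = divergence i ξ + divergence i η := by
  simp only [divergence_eq_sum, LinearMap.add_apply, map_add, smul_add, Finset.sum_add_distrib]

theorem divergence_smul (i : ZMod 2) (c : k) (ξ : Module.End k (FormalFun k l n)) :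
    divergence i (c • ξ) = c • divergence i ξ := by
  simp only [divergence_eq_sum, LinearMap.smul_apply, map_smul, Finset.smul_sum]
  exact Finset.sum_congr rfl fun z _ => smul_comm _ _ _

theorem divergence_sub (i : ZMod 2) (ξ η : Module.End k (FormalFun k l n)) :
    divergence i (ξ - η) = divergence i ξ - divergence i η := by
  rw [sub_eq_add_neg, ← neg_one_smul k η, divergence_add, divergence_smul, neg_one_smul,
    sub_eq_add_neg]

theorem divergence_zero (i : ZMod 2) : divergence i (0 : Module.End k (FormalFun k l n)) = 0 := by
  simpa using divergence_smul i (0 : k) (0 : Module.End k (FormalFun k l n))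

theorem divergence_sum {ι : Type*} (s : Finset ι) (i : ZMod 2)
    (ξ : ι → Module.End k (FormalFun k l n)) :
    divergence i (∑ t ∈ s, ξ t) = ∑ t ∈ s, divergence i (ξ t) :=
  map_sum (⟨⟨divergence i, divergence_zero i⟩, divergence_add i⟩ :
    Module.End k (FormalFun k l n) →+ FormalFun k l n) ξ s

theorem partialCoord_mem_lengthGE (z : CoordIdx l n) {a : FormalFun k l n}
    (ha : a ∈ lengthGE k l n (p + 1)) : partialCoord k z a ∈ lengthGE k l n p :=
  (isVectorField_partialCoord z).map_lengthGE (by omega) ha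

theorem IsVectorField.divergence_mem_lengthGE (h : IsVectorField i (p + 1) ξ) :
    divergence i ξ ∈ lengthGE k l n p := by
  rw [divergence_eq_sum]
  exact Submodule.sum_mem _ fun z _ => Submodule.smul_mem _ _
    (partialCoord_mem_lengthGE z (h.map_coord z))

theorem IsVectorField.divergence_mem_parityPart (h : IsVectorField i p ξ) :
    divergence i ξ ∈ parityPart k l n i := by
  rw [divergence_eq_sum]
  refine Submodule.sum_mem _ fun z _ => Submodule.smul_mem _ _ ?_
  have := (isVectorField_partialCoord (k := k) z).map_parity _ _ (h.map_coord_parity z)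
  have e : ∀ i s : ZMod 2, s + (i + s) = i := by decide
  rwa [e] at this

/-- The supercommutator [∂_z, ξ] is a vector field, and its value on a coordinate w is ∂_z (ξ w),
because ξ kills the constant ∂_z w. Expanding it in coordinates gives the formula. -/
theorem IsVectorField.partialCoord_apply (h : IsVectorField i (p + 1) ξ) (z : CoordIdx l n)
    (a : FormalFun k l n) :
    partialCoord k z (ξ a) = sgn k (coordParity z * i) • ξ (partialCoord k z a) +
      ∑ w, partialCoord k z (ξ (coord k w)) * partialCoord k w a := by
  have hb := (isVectorField_partialCoord (k := k) z).superBracket h (r := 0) (by omega)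
  have e := hb.apply_eq_sum a
  rw [superBracket_apply, sub_eq_iff_eq_add'] at e
  rw [e]
  congr 1
  refine Finset.sum_congr rfl fun w _ => ?_
  rw [superBracket_apply, partialCoord_coord]
  split_ifs
  · rw [h.map_one, smul_zero, sub_zero]
  · rw [map_zero, smul_zero, sub_zero]

/-- The divergence is a cocycle. -/
theorem divergence_superBracket (h : IsVectorField i (p + 1) ξ) (h' : IsVectorField j (q + 1) η) :
    divergence (i + j) (superBracket i j ξ η) =
      ξ (divergence j η) - sgn k (i * j) • η (divergence i ξ) := by
  -- The terms quadratic in first derivatives form the supertrace of a product of two Jacobian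
  -- matrices. Exchanging z and w swaps the factors up to the Koszul sign, so these terms cancel in
  -- the supercommutator.
  have cross : ∑ z : CoordIdx l n, ∑ w : CoordIdx l n,
      sgn k ((i + j + coordParity z) * coordParity z) •
        (partialCoord k z (ξ (coord k w)) * partialCoord k w (η (coord k z))) =
      ∑ z : CoordIdx l n, ∑ w : CoordIdx l n,
      (sgn k ((i + j + coordParity z) * coordParity z) * sgn k (i * j)) •
        (partialCoord k z (η (coord k w)) * partialCoord k w (ξ (coord k z))) := by
    rw [Finset.sum_comm]
    refine Finset.sum_congr rfl fun z _ => Finset.sum_congr rfl fun w _ => ?_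
    rw [supercomm ((isVectorField_partialCoord (k := k) w).map_parity _ _ (h.map_coord_parity z))
      ((isVectorField_partialCoord (k := k) z).map_parity _ _ (h'.map_coord_parity w)), smul_smul,
      ← sgn_add, ← sgn_add]
    have e : ∀ i j s t : ZMod 2, (i + j + t) * t + (t + (i + s)) * (s + (j + t)) =
      (i + j + s) * s + i * j := by decide
    rw [e]
  have e1 : ∀ i j s : ZMod 2, (i + j + s) * s + s * i = (j + s) * s := by decide
  have e2 : ∀ i j s : ZMod 2, (i + j + s) * s + (i * j + s * j) = i * j + (i + s) * s := by decide
  have expand : ∀ z : CoordIdx l n, sgn k ((i + j + coordParity z) * coordParity z) •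
      partialCoord k z (superBracket i j ξ η (coord k z)) =
      ξ (sgn k ((j + coordParity z) * coordParity z) • partialCoord k z (η (coord k z))) -
      sgn k (i * j) •
        η (sgn k ((i + coordParity z) * coordParity z) • partialCoord k z (ξ (coord k z))) +
      (∑ w : CoordIdx l n, sgn k ((i + j + coordParity z) * coordParity z) •
        (partialCoord k z (ξ (coord k w)) * partialCoord k w (η (coord k z))) -
      ∑ w : CoordIdx l n,
        (sgn k ((i + j + coordParity z) * coordParity z) * sgn k (i * j)) •
        (partialCoord k z (η (coord k w)) * partialCoord k w (ξ (coord k z)))) := fun z => by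
    rw [superBracket_apply, map_sub, map_smul, h.partialCoord_apply z (η (coord k z)),
      h'.partialCoord_apply z (ξ (coord k z)), map_smul, map_smul, smul_smul (sgn k (i * j)),
      ← e1 i j, ← sgn_add (i * j), ← e2 i j, ← Finset.smul_sum, ← Finset.smul_sum]
    simp only [sgn_add]
    module
  rw [divergence_eq_sum, divergence_eq_sum, divergence_eq_sum, map_sum, map_sum, Finset.smul_sum,
    Finset.sum_congr rfl fun z _ => expand z, Finset.sum_add_distrib, Finset.sum_sub_distrib,
    Finset.sum_sub_distrib, cross, sub_self, add_zero]

end VectorFields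

/-! ### Convergent series of functions and operators -/

section Sums

variable {k : Type*} [Field k] {l n : ℕ} {i : ZMod 2} {p : ℕ}

/-- The sum of a series of functions `a r ∈ Ŝ_{≥ r}`, each coefficient being a finite sum. -/
def seriesSum (a : ℕ → FormalFun k l n) : FormalFun k l n := fun e =>
  ∑ r ∈ Finset.range (e.degree + l + 1), MvPowerSeries.coeff e (a r)

/-- The range is padded by an arbitrary N, adding only zero terms, so that the sum can be compared
with its N-th partial sum. -/
theorem coeff_seriesSum {a : ℕ → FormalFun k l n} (ha : ∀ r, a r ∈ lengthGE k l n r)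
    (e : Fin n →₀ ℕ) (N : ℕ) : MvPowerSeries.coeff e (seriesSum a) =
      ∑ r ∈ Finset.range (N + (e.degree + l + 1)), MvPowerSeries.coeff e (a r) := by
  rw [add_comm N, Finset.sum_range_add, Finset.sum_eq_zero (s := Finset.range N), add_zero]
  · rfl
  · exact fun r _ => coeff_eq_zero_of_mem_lengthGE (ha _) (by omega)

theorem seriesSum_sub_mem {a : ℕ → FormalFun k l n} (ha : ∀ r, a r ∈ lengthGE k l n r) (N : ℕ) :
    seriesSum a - ∑ r ∈ Finset.range N, a r ∈ lengthGE k l n N := fun e => by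
  rw [map_sub, coeff_seriesSum ha e N, Finset.sum_range_add, map_sum, add_sub_cancel_left]
  exact Submodule.sum_mem _ fun r _ => extGE_mono (by omega) (ha (N + r) e)

theorem mem_parityPart_of_approx {a : FormalFun k l n}
    (h : ∀ N, ∃ b ∈ parityPart k l n i, a - b ∈ lengthGE k l n N) : a ∈ parityPart k l n i :=
  fun e => by
    obtain ⟨b, hb, hab⟩ := h (e.degree + l + 1)
    have := coeff_eq_zero_of_mem_lengthGE hab (Nat.lt_succ_self _)
    rw [map_sub, sub_eq_zero] at this
    rw [this]
    exact hb e

theorem seriesSum_mem_parityPart {a : ℕ → FormalFun k l n} (ha : ∀ r, a r ∈ lengthGE k l n r)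
    (hp : ∀ r, a r ∈ parityPart k l n i) : seriesSum a ∈ parityPart k l n i :=
  mem_parityPart_of_approx fun N =>
    ⟨_, Submodule.sum_mem _ fun r _ => hp r, seriesSum_sub_mem ha N⟩

/-- The pointwise sum of a series of operators. -/
def operatorSum (Q : ℕ → Module.End k (FormalFun k l n)) : Module.End k (FormalFun k l n) where
  toFun a := seriesSum fun r => Q r a
  map_add' a b := by
    ext e
    change ∑ r ∈ Finset.range (e.degree + l + 1), MvPowerSeries.coeff e (Q r (a + b)) =
      ∑ r ∈ Finset.range (e.degree + l + 1), MvPowerSeries.coeff e (Q r a) +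
        ∑ r ∈ Finset.range (e.degree + l + 1), MvPowerSeries.coeff e (Q r b)
    simp only [map_add, Finset.sum_add_distrib]
  map_smul' c a := by
    ext e
    change ∑ r ∈ Finset.range (e.degree + l + 1), MvPowerSeries.coeff e (Q r (c • a)) =
      c • ∑ r ∈ Finset.range (e.degree + l + 1), MvPowerSeries.coeff e (Q r a)
    simp only [map_smul, Finset.smul_sum, coeff_smul_field]

theorem operatorSum_sub_mem {Q : ℕ → Module.End k (FormalFun k l n)}
    (hQ : ∀ r, IsVectorField i (r + 1) (Q r)) (N : ℕ) (a : FormalFun k l n) :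
    (operatorSum Q - ∑ r ∈ Finset.range N, Q r) a ∈ lengthGE k l n N := by
  rw [LinearMap.sub_apply, LinearMap.sum_apply]
  exact seriesSum_sub_mem (fun r => (hQ r).map_lengthGE (q := 0) (by omega) (mem_lengthGE_zero a)) N

/-- The Leibniz defect of ξ equals that of ξ - η for any field η, so uniform approximation by fields
gives it arbitrarily large length. -/
theorem isVectorField_of_approx {ξ : Module.End k (FormalFun k l n)}
    (h : ∀ N, ∃ η : Module.End k (FormalFun k l n), IsVectorField i 0 η ∧ ∀ a, (ξ - η) a ∈ lengthGE k l n N) :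
    IsVectorField i 0 ξ := by
  refine ⟨fun j a ha => mem_parityPart_of_approx fun N => ?_, fun j a ha b => ?_,
    fun _ => mem_lengthGE_zero _, fun _ => mem_lengthGE_zero _⟩
  · obtain ⟨η, hη, hξ⟩ := h N
    exact ⟨η a, hη.map_parity j a ha, hξ a⟩
  · rw [← sub_eq_zero]
    refine eq_zero_of_forall_mem_lengthGE fun N => ?_
    obtain ⟨η, hη, hξ⟩ := h N
    have e : ξ (a * b) - (ξ a * b + sgn k (i * j) • (a * ξ b)) = (ξ - η) (a * b) -
        ((ξ - η) a * b + sgn k (i * j) • (a * (ξ - η) b)) := by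
      simp only [LinearMap.sub_apply]
      rw [hη.leibniz j a ha b, sub_mul, mul_sub, smul_sub]
      abel
    have h1 : (ξ - η) a * b ∈ lengthGE k l n N :=
      lengthGE_mono (Nat.le_add_right N 0) (lengthGE_mul (hξ a) (mem_lengthGE_zero b))
    have h2 : a * (ξ - η) b ∈ lengthGE k l n N :=
      lengthGE_mono (Nat.le_add_left N 0) (lengthGE_mul (mem_lengthGE_zero a) (hξ b))
    rw [e]
    exact Submodule.sub_mem _ (hξ _) (Submodule.add_mem _ h1 (Submodule.smul_mem _ _ h2))

theorem isVectorField_operatorSum_sub {Q : ℕ → Module.End k (FormalFun k l n)}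
    (hQ : ∀ r, IsVectorField i (r + 1) (Q r)) (N : ℕ) :
    IsVectorField i (N + 1) (operatorSum Q - ∑ r ∈ Finset.range N, Q r) := by
  have hs : ∀ N, IsVectorField i 0 (∑ r ∈ Finset.range N, Q r) := fun N =>
    IsVectorField.sum _ fun r _ => (hQ r).mono (Nat.zero_le _)
  refine ((isVectorField_of_approx fun N => ⟨_, hs N, operatorSum_sub_mem hQ N⟩).sub
    (hs N)).of_coord fun z => ?_
  -- The tail after N terms is only known to have values of length N. One more term is split off to
  -- gain a length, and that term sends coordinates to length N + 1 by hypothesis.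
  have := operatorSum_sub_mem hQ (N + 1) (coord k z)
  rw [Finset.sum_range_succ, ← sub_sub, LinearMap.sub_apply] at this
  rw [← sub_add_cancel ((operatorSum Q - ∑ r ∈ Finset.range N, Q r) (coord k z)) (Q N (coord k z))]
  exact Submodule.add_mem _ this ((hQ N).map_coord z)

theorem isVectorField_operatorSum {Q : ℕ → Module.End k (FormalFun k l n)}
    (hQ : ∀ r, IsVectorField i (r + 1) (Q r)) : IsVectorField i 1 (operatorSum Q) := by
  simpa using isVectorField_operatorSum_sub hQ 0

/-- A double sum over a square is controlled by its diagonals and by its terms of high order. -/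
theorem sum_square_sub_sum_antidiagonal_mem {M : Type*} [AddCommGroup M] [Module k M]
    (S : Submodule k M) (N : ℕ) (F : ℕ → ℕ → M) (hF : ∀ i j, N ≤ i + j → F i j ∈ S) :
    ∑ i ∈ Finset.range N, ∑ j ∈ Finset.range N, F i j -
      ∑ r ∈ Finset.range N, ∑ x ∈ Finset.HasAntidiagonal.antidiagonal r, F x.1 x.2 ∈ S := by
  have e : ∑ r ∈ Finset.range N, ∑ x ∈ Finset.HasAntidiagonal.antidiagonal r, F x.1 x.2 =
      ∑ i ∈ Finset.range N, ∑ j ∈ Finset.range (N - i), F i j := by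
    rw [← Finset.sum_range_diag_flip]
    exact Finset.sum_congr rfl fun r _ => Finset.Nat.sum_antidiagonal_eq_sum_range_succ F r
  rw [e, ← Finset.sum_sub_distrib]
  refine Submodule.sum_mem _ fun i hi => ?_
  rw [Finset.mem_range] at hi
  have h := Finset.sum_range_add (F i) (N - i) i
  rw [Nat.sub_add_cancel hi.le] at h
  rw [h, add_sub_cancel_left]
  exact Submodule.sum_mem _ fun j _ => hF _ _ (by omega)

/-- This is the product rule for the t-derivative of a product of two power series in t, read off in
degree r. It lets the flow e^{tξ} be handled coefficient by coefficient. -/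
theorem succ_smul_sum_antidiagonal {M : Type*} [AddCommGroup M] [Module k M]
    (F : ℕ → ℕ → M) (r : ℕ) :
    ((r + 1 : ℕ) : k) • ∑ x ∈ Finset.HasAntidiagonal.antidiagonal (r + 1), F x.1 x.2 =
      ∑ x ∈ Finset.HasAntidiagonal.antidiagonal r, (((x.1 + 1 : ℕ) : k) • F (x.1 + 1) x.2 +
        ((x.2 + 1 : ℕ) : k) • F x.1 (x.2 + 1)) := by
  have h1 := Finset.Nat.sum_antidiagonal_succ (n := r) (f := fun x => (x.1 : k) • F x.1 x.2)
  have h2 := Finset.Nat.sum_antidiagonal_succ' (n := r) (f := fun x => (x.2 : k) • F x.1 x.2)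
  simp only [Nat.cast_zero, zero_smul, zero_add] at h1 h2
  rw [Finset.sum_add_distrib, ← h1, ← h2, ← Finset.sum_add_distrib, Finset.smul_sum]
  refine Finset.sum_congr rfl fun x hx => ?_
  rw [Finset.HasAntidiagonal.mem_antidiagonal] at hx
  rw [← add_smul, ← Nat.cast_add, hx]

end Sums

/-! ### The gauge flow, order by order -/

section Gauge

variable {k : Type*} [Field k] {l n : ℕ}

/-- The term of order `r` of the conjugate `e^ξ Q e^{-ξ}`. -/
def gaugeField (ξ Q : Module.End k (FormalFun k l n)) (r : ℕ) : Module.End k (FormalFun k l n) :=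
  (r.factorial : k)⁻¹ • (superBracket 0 1 ξ)^[r] Q

/-- The term of order `r` of the action of `(ξ, 0)` on the function `f`. -/
def gaugeFun (ξ : Module.End k (FormalFun k l n)) (f : FormalFun k l n) : ℕ → FormalFun k l n
  | 0 => f
  | r + 1 => ((r + 1).factorial : k)⁻¹ • (ξ ^ r) (ξ f + (2⁻¹ : k) • divergence 0 ξ)

theorem IsVectorField.pow_apply_mem_lengthGE {ξ : Module.End k (FormalFun k l n)}
    (hξ : IsVectorField 0 2 ξ) {q : ℕ} {a : FormalFun k l n} (ha : a ∈ lengthGE k l n q) (r : ℕ) :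
    (ξ ^ r) a ∈ lengthGE k l n (q + r) := by
  induction r with
  | zero => exact ha
  | succ r ih =>
    rw [pow_succ', Module.End.mul_apply]
    exact hξ.map_lengthGE (by omega) ih

theorem IsVectorField.pow_apply_mem_parityPart {ξ : Module.End k (FormalFun k l n)} {p : ℕ}
    (hξ : IsVectorField 0 p ξ) {i : ZMod 2} {a : FormalFun k l n} (ha : a ∈ parityPart k l n i)
    (r : ℕ) : (ξ ^ r) a ∈ parityPart k l n i := by
  induction r with
  | zero => exact ha
  | succ r ih =>
    rw [pow_succ', Module.End.mul_apply]
    simpa using hξ.map_parity _ _ ih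

theorem gaugeFun_mem_lengthGE {ξ : Module.End k (FormalFun k l n)} (hξ : IsVectorField 0 2 ξ)
    {f : FormalFun k l n} (hf : f ∈ lengthGE k l n 1) (r : ℕ) :
    gaugeFun ξ f r ∈ lengthGE k l n r := by
  rcases r with _ | r
  · exact mem_lengthGE_zero f
  · refine Submodule.smul_mem _ _ ?_
    rw [add_comm]
    exact hξ.pow_apply_mem_lengthGE (Submodule.add_mem _ (hξ.map_lengthGE (by omega) hf)
      (Submodule.smul_mem _ _ hξ.divergence_mem_lengthGE)) r

theorem gaugeFun_mem_parityPart {ξ : Module.End k (FormalFun k l n)} {p : ℕ}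
    (hξ : IsVectorField 0 p ξ)
    {f : FormalFun k l n} (hf : f ∈ parityPart k l n 0) (r : ℕ) :
    gaugeFun ξ f r ∈ parityPart k l n 0 := by
  rcases r with _ | r
  · exact hf
  · refine Submodule.smul_mem _ _ (hξ.pow_apply_mem_parityPart (Submodule.add_mem _ ?_
      (Submodule.smul_mem _ _ hξ.divergence_mem_parityPart)) r)
    simpa using hξ.map_parity _ _ hf

theorem isVectorField_gaugeField {ξ Q : Module.End k (FormalFun k l n)}
    (hξ : IsVectorField 0 2 ξ) (hQ : IsVectorField 1 1 Q) (r : ℕ) :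
    IsVectorField 1 (r + 1) (gaugeField ξ Q r) := by
  refine IsVectorField.smul ?_ _
  induction r with
  | zero => exact hQ
  | succ r ih =>
    rw [Function.iterate_succ_apply']
    exact hξ.superBracket ih (by omega)

/-- Coefficient form of the flow equation Q_t' = [ξ, Q_t]. -/
theorem succ_smul_gaugeField [CharZero k] (ξ Q : Module.End k (FormalFun k l n)) (r : ℕ) :
    ((r + 1 : ℕ) : k) • gaugeField ξ Q (r + 1) =
      ξ * gaugeField ξ Q r - gaugeField ξ Q r * ξ := by
  have h : ((r + 1 : ℕ) : k) ≠ 0 := Nat.cast_ne_zero.mpr (Nat.succ_ne_zero r)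
  rw [gaugeField, gaugeField, Function.iterate_succ_apply', smul_smul, Nat.factorial_succ,
    Nat.cast_mul, mul_inv, mul_inv_cancel_left₀ h, superBracket, zero_mul, sgn_zero, one_smul,
    smul_sub, mul_smul_comm, smul_mul_assoc]

/-- Coefficient form of f_t' = ξ f_t + ½∇ξ; the inhomogeneous term is constant in t and enters only
at r = 0. -/
theorem succ_smul_gaugeFun [CharZero k] (ξ : Module.End k (FormalFun k l n))
    (f : FormalFun k l n) (r : ℕ) :
    ((r + 1 : ℕ) : k) • gaugeFun ξ f (r + 1) =
      ξ (gaugeFun ξ f r) + if r = 0 then (2⁻¹ : k) • divergence 0 ξ else 0 := by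
  rcases r with _ | r
  · simp [gaugeFun]
  · have h : ((r + 1 + 1 : ℕ) : k) ≠ 0 := Nat.cast_ne_zero.mpr (Nat.succ_ne_zero _)
    rw [if_neg (Nat.succ_ne_zero r), add_zero, gaugeFun, gaugeFun, smul_smul,
      Nat.factorial_succ (r + 1), Nat.cast_mul, mul_inv, mul_inv_cancel_left₀ h, pow_succ',
      Module.End.mul_apply, map_smul]

/-- The sum is the coefficient of t^r in Q_t², which solves the linear equation (Q_t²)' = [ξ, Q_t²]
with initial value 0. -/
theorem sum_gaugeField_mul_eq_zero [CharZero k] {ξ Q : Module.End k (FormalFun k l n)}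
    (hQ : Q * Q = 0) (r : ℕ) :
    ∑ x ∈ Finset.HasAntidiagonal.antidiagonal r, gaugeField ξ Q x.1 * gaugeField ξ Q x.2 = 0 := by
  induction r with
  | zero => simpa [gaugeField] using hQ
  | succ r ih =>
    have h : ((r + 1 : ℕ) : k) ≠ 0 := Nat.cast_ne_zero.mpr (Nat.succ_ne_zero r)
    refine (smul_eq_zero_iff_right h).mp ?_
    rw [succ_smul_sum_antidiagonal fun i j => gaugeField ξ Q i * gaugeField ξ Q j]
    have e : ∀ x ∈ Finset.HasAntidiagonal.antidiagonal r,
        ((x.1 + 1 : ℕ) : k) • (gaugeField ξ Q (x.1 + 1) * gaugeField ξ Q x.2) +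
          ((x.2 + 1 : ℕ) : k) • (gaugeField ξ Q x.1 * gaugeField ξ Q (x.2 + 1)) =
        ξ * (gaugeField ξ Q x.1 * gaugeField ξ Q x.2) -
          gaugeField ξ Q x.1 * gaugeField ξ Q x.2 * ξ := fun x _ => by
      rw [← smul_mul_assoc, ← mul_smul_comm, succ_smul_gaugeField, succ_smul_gaugeField]
      rw [sub_mul, mul_sub, mul_assoc, mul_assoc, mul_assoc]
      abel
    rw [Finset.sum_congr rfl e, Finset.sum_sub_distrib, ← Finset.mul_sum, ← Finset.sum_mul, ih,
      mul_zero, zero_mul, sub_zero]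

/-- The expression E_t = Q_t f_t + ½∇Q_t satisfies E_t' = ξ E_t and starts at 0. The term ½ Q_t ∇ξ
coming from f_t' cancels against the one in ½∇[ξ, Q_t], by the cocycle identity. -/
theorem sum_gaugeField_gaugeFun_eq_zero [CharZero k] {ξ Q : Module.End k (FormalFun k l n)}
    {f : FormalFun k l n} (hξ : IsVectorField 0 2 ξ) (hQ : IsVectorField 1 1 Q)
    (h0 : Q f + (2⁻¹ : k) • divergence 1 Q = 0) (r : ℕ) :
    ∑ x ∈ Finset.HasAntidiagonal.antidiagonal r, gaugeField ξ Q x.1 (gaugeFun ξ f x.2) +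
      (2⁻¹ : k) • divergence 1 (gaugeField ξ Q r) = 0 := by
  induction r with
  | zero => simpa [gaugeField, gaugeFun] using h0
  | succ r ih =>
    have h : ((r + 1 : ℕ) : k) ≠ 0 := Nat.cast_ne_zero.mpr (Nat.succ_ne_zero r)
    refine (smul_eq_zero_iff_right h).mp ?_
    rw [smul_add, succ_smul_sum_antidiagonal fun i j => gaugeField ξ Q i (gaugeFun ξ f j),
      smul_comm, ← divergence_smul, succ_smul_gaugeField]
    have hb : ξ * gaugeField ξ Q r - gaugeField ξ Q r * ξ =
        superBracket 0 1 ξ (gaugeField ξ Q r) := by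
      rw [superBracket, zero_mul, sgn_zero, one_smul]
    have hd := divergence_superBracket hξ (isVectorField_gaugeField hξ hQ r)
    rw [zero_mul, sgn_zero, one_smul, zero_add] at hd
    rw [hb, hd]
    -- The pair (r, 0) is the only one on the diagonal that meets the inhomogeneous term of the
    -- equation for f_t.
    have e : ∀ x ∈ Finset.HasAntidiagonal.antidiagonal r,
        ((x.1 + 1 : ℕ) : k) • gaugeField ξ Q (x.1 + 1) (gaugeFun ξ f x.2) +
          ((x.2 + 1 : ℕ) : k) • gaugeField ξ Q x.1 (gaugeFun ξ f (x.2 + 1)) =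
        ξ (gaugeField ξ Q x.1 (gaugeFun ξ f x.2)) +
          if x = (r, 0) then gaugeField ξ Q r ((2⁻¹ : k) • divergence 0 ξ) else 0 := fun x hx => by
      rw [← LinearMap.smul_apply, ← map_smul, succ_smul_gaugeField, succ_smul_gaugeFun, map_add,
        LinearMap.sub_apply, Module.End.mul_apply, Module.End.mul_apply, ← add_assoc,
        sub_add_cancel]
      congr 1
      rw [Finset.HasAntidiagonal.mem_antidiagonal] at hx
      obtain ⟨a, b⟩ := x
      dsimp only at hx ⊢
      by_cases hb : b = 0
      · subst hb
        obtain rfl : a = r := by omega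
        simp
      · simp [hb]
    rw [Finset.sum_congr rfl e, Finset.sum_add_distrib, ← map_sum, Finset.sum_ite_eq',
      if_pos (by simp), map_smul, smul_sub]
    have := congrArg ξ ih
    rw [map_add, map_zero, map_smul] at this
    rw [← this]
    abel

end Gauge

/-! ### The gauge action on unimodular structures -/

section GaugeAction

variable {k : Type*} [Field k] {l n : ℕ}

/-- The function `f'` in `e^{(ξ, 0)} · (m, f) = (m', f')`. -/
def gaugeFunSum (ξ : Module.End k (FormalFun k l n)) (f : FormalFun k l n) : FormalFun k l n :=
  seriesSum (gaugeFun ξ f)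

/-- The conjugate `e^ξ Q e^{-ξ}`. -/
def gaugeFieldSum (ξ Q : Module.End k (FormalFun k l n)) : Module.End k (FormalFun k l n) :=
  operatorSum (gaugeField ξ Q)

theorem gaugeFieldSum_mul_self [CharZero k] {ξ Q : Module.End k (FormalFun k l n)}
    (hξ : IsVectorField 0 2 ξ) (hQ : IsVectorField 1 1 Q) (h2 : Q * Q = 0) :
    gaugeFieldSum ξ Q * gaugeFieldSum ξ Q = 0 := by
  refine LinearMap.ext fun a => eq_zero_of_forall_mem_lengthGE fun N => ?_
  have hq := isVectorField_gaugeField hξ hQ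
  set q := gaugeField ξ Q with hqdef
  set Q' := gaugeFieldSum ξ Q
  set s := ∑ r ∈ Finset.range N, q r with hs
  have hQ' : IsVectorField 1 1 Q' := isVectorField_operatorSum hq
  have hd : ∀ a, (Q' - s) a ∈ lengthGE k l n N := operatorSum_sub_mem hq N
  have hsv : IsVectorField 1 1 s := IsVectorField.sum _ fun r _ => (hq r).mono (by omega)
  -- In the square of the truncation the complete diagonals vanish, and the remaining terms have
  -- total order at least N.
  have hss : (s * s) a ∈ lengthGE k l n N := by
    have h := sum_square_sub_sum_antidiagonal_mem (lengthGE k l n N) N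
      (fun i j => q i (q j a)) fun i j hij =>
        (hq i).map_lengthGE (q := j) (by omega) ((hq j).map_lengthGE (q := 0) (by omega)
          (mem_lengthGE_zero a))
    have h0 : ∀ r, ∑ x ∈ Finset.HasAntidiagonal.antidiagonal r, q x.1 (q x.2 a) = 0 := fun r => by
      have := LinearMap.congr_fun (sum_gaugeField_mul_eq_zero (ξ := ξ) h2 r) a
      simpa using this
    simp only [h0, Finset.sum_const_zero, sub_zero] at h
    rw [Finset.sum_comm] at h
    rw [Module.End.mul_apply, hs]
    simpa using h
  have e : (Q' * Q') a = (Q' - s) (Q' a) + s ((Q' - s) a) + (s * s) a := by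
    simp only [LinearMap.sub_apply, Module.End.mul_apply, map_sub]
    abel
  rw [e]
  exact Submodule.add_mem _ (Submodule.add_mem _ (hd _) (hsv.map_lengthGE (by omega) (hd a))) hss

theorem gaugeFieldSum_gaugeFunSum [CharZero k] {ξ Q : Module.End k (FormalFun k l n)}
    {f : FormalFun k l n} (hξ : IsVectorField 0 2 ξ) (hQ : IsVectorField 1 1 Q)
    (hf : f ∈ lengthGE k l n 1) (h0 : Q f + (2⁻¹ : k) • divergence 1 Q = 0) :
    gaugeFieldSum ξ Q (gaugeFunSum ξ f) + (2⁻¹ : k) • divergence 1 (gaugeFieldSum ξ Q) = 0 := by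
  refine eq_zero_of_forall_mem_lengthGE fun N => ?_
  have hq := isVectorField_gaugeField hξ hQ
  have hg := gaugeFun_mem_lengthGE hξ hf
  have hdv := isVectorField_operatorSum_sub hq N
  have hd := operatorSum_sub_mem hq N (gaugeFunSum ξ f)
  have hdf := seriesSum_sub_mem hg N
  have key := sum_gaugeField_gaugeFun_eq_zero hξ hQ h0
  change IsVectorField 1 (N + 1) (gaugeFieldSum ξ Q - _) at hdv
  change (gaugeFieldSum ξ Q - _) _ ∈ _ at hd
  change gaugeFunSum ξ f - _ ∈ _ at hdf
  generalize gaugeFieldSum ξ Q = Q' at *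
  generalize gaugeFunSum ξ f = f' at *
  generalize gaugeField ξ Q = q at *
  generalize gaugeFun ξ f = g at *
  have hsv : IsVectorField 1 1 (∑ r ∈ Finset.range N, q r) :=
    IsVectorField.sum _ fun r _ => (hq r).mono (by omega)
  have hss : (∑ r ∈ Finset.range N, q r) (∑ r ∈ Finset.range N, g r) +
      (2⁻¹ : k) • divergence 1 (∑ r ∈ Finset.range N, q r) ∈ lengthGE k l n N := by
    have h := sum_square_sub_sum_antidiagonal_mem (lengthGE k l n N) N
      (fun i j => q i (g j)) fun i j hij => (hq i).map_lengthGE (q := j) (by omega) (hg j)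
    have e : ∀ r, ∑ x ∈ Finset.HasAntidiagonal.antidiagonal r, q x.1 (g x.2) =
        -((2⁻¹ : k) • divergence 1 (q r)) := fun r => eq_neg_of_add_eq_zero_left (key r)
    simp only [e, Finset.sum_neg_distrib, sub_neg_eq_add] at h
    rw [Finset.sum_comm] at h
    rw [divergence_sum, Finset.smul_sum]
    simpa using h
  have e : Q' f' + (2⁻¹ : k) • divergence 1 Q' =
      (Q' - ∑ r ∈ Finset.range N, q r) f' +
      (∑ r ∈ Finset.range N, q r) (f' - ∑ r ∈ Finset.range N, g r) +
      (2⁻¹ : k) • divergence 1 (Q' - ∑ r ∈ Finset.range N, q r) +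
      ((∑ r ∈ Finset.range N, q r) (∑ r ∈ Finset.range N, g r) +
      (2⁻¹ : k) • divergence 1 (∑ r ∈ Finset.range N, q r)) := by
    rw [LinearMap.sub_apply, map_sub, divergence_sub, smul_sub]
    abel
  rw [e]
  exact Submodule.add_mem _ (Submodule.add_mem _ (Submodule.add_mem _ hd
    (hsv.map_lengthGE (by omega) hdf)) (Submodule.smul_mem _ _ hdv.divergence_mem_lengthGE)) hss

theorem bracket_iterate (ξ η : Module.End k (FormalFun k l n)) (g : FormalFun k l n) (r : ℕ) :
    (bracket 0 1 (ξ, (0 : FormalFun k l n)))^[r] (η, g) =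
      ((superBracket 0 1 ξ)^[r] η, (ξ ^ r) g) := by
  induction r with
  | zero => rfl
  | succ r ih =>
    rw [Function.iterate_succ_apply', ih, Function.iterate_succ_apply', pow_succ']
    simp [bracket]

/-- Since -[D, ξ] = [ξ, D], the differential merges with the bracket and the action becomes
conjugation of D + m. The upper limit moves to N + 1 because x itself supplies the terms of order 0.
-/
theorem gaugePartialSum_eq (D ξ m : Module.End k (FormalFun k l n)) (f : FormalFun k l n) (N : ℕ) :
    gaugePartialSum D (ξ, 0) (m, f) N =
      (∑ r ∈ Finset.range (N + 1), gaugeField ξ (D + m) r - D,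
        ∑ r ∈ Finset.range (N + 1), gaugeFun ξ f r) := by
  have e : bracket 0 1 (ξ, 0) (m, f) - differential D 0 (ξ, 0) =
      (superBracket 0 1 ξ (D + m), ξ f + (2⁻¹ : k) • divergence 0 ξ) := by
    refine Prod.ext ?_ ?_
    · simp only [bracket, differential, superBracket, Prod.fst_sub, zero_mul, mul_zero, sgn_zero,
        one_smul]
      noncomm_ring
    · simp [bracket, differential, sgn_zero]
  rw [gaugePartialSum, e]
  simp only [bracket_iterate]
  rw [Finset.sum_range_succ', Finset.sum_range_succ']
  refine Prod.ext ?_ ?_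
  · rw [Prod.fst_add, Prod.fst_sum]
    simp only [Prod.smul_fst, gaugeField, Function.iterate_succ_apply, Nat.factorial_zero,
      Nat.cast_one, inv_one, one_smul, Function.iterate_zero, id_eq]
    abel
  · rw [Prod.snd_add, Prod.snd_sum, add_comm]
    rfl

theorem superBracket_one_one (ξ η : Module.End k (FormalFun k l n)) :
    superBracket 1 1 ξ η = ξ * η + η * ξ := by
  refine LinearMap.ext fun a => ?_
  rw [superBracket_apply, mul_one, sgn_one, neg_one_smul, sub_neg_eq_add]
  rfl

/-- The gauge action of an even vector field in `Der_{≥ 2}`. -/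
theorem IsUnimodular.gauge [CharZero k] {D ξ m : Module.End k (FormalFun k l n)}
    {f : FormalFun k l n} (hD : IsVectorField 1 1 D) (hDD : D * D = 0)
    (hdiv : divergence 1 D = 0) (h : IsUnimodular D m f) (hξ : IsVectorField 0 2 ξ) :
    IsUnimodular D (gaugeFieldSum ξ (D + m) - D) (gaugeFunSum ξ f) ∧
      GaugeEquiv D (m, f) (gaugeFieldSum ξ (D + m) - D, gaugeFunSum ξ f) := by
  have hQ : IsVectorField 1 1 (D + m) := hD.add (h.isVectorField.mono (by omega))
  -- For an odd operator Q, the Maurer–Cartan expression of Q - D is Q² - D².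
  have hss : ∀ Q : Module.End k (FormalFun k l n), superBracket 1 1 D (Q - D) +
      (2⁻¹ : k) • superBracket 1 1 (Q - D) (Q - D) = Q * Q - D * D := fun Q => by
    rw [superBracket_one_one, superBracket_one_one, ← two_smul k ((Q - D) * (Q - D)), smul_smul, inv_mul_cancel₀ two_ne_zero, one_smul,
      mul_sub, mul_sub, sub_mul, sub_mul]
    abel
  have hQQ : (D + m) * (D + m) = 0 := by
    have := hss (D + m)
    rw [add_sub_cancel_left, h.mc_field, hDD, sub_zero] at this
    exact this.symm
  have hQf : (D + m) f + (2⁻¹ : k) • divergence 1 (D + m) = 0 := by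
    rw [divergence_add, hdiv, zero_add, ← h.mc_function, LinearMap.add_apply]
    abel
  have hq := isVectorField_gaugeField hξ hQ
  have hg := gaugeFun_mem_lengthGE hξ h.lengthGE_one
  have hgp := gaugeFun_mem_parityPart hξ h.even
  refine ⟨⟨?_, seriesSum_mem_parityPart hg hgp, ?_, ?_, ?_⟩, (ξ, 0), ⟨hξ, Submodule.zero_mem _,
    Submodule.zero_mem _⟩, fun p => ?_⟩
  -- Removing the order 0 term D + m from the conjugate leaves a field in Der_{≥ 2}; adding m back
  -- gives the conjugate minus D.
  · have := (isVectorField_operatorSum_sub hq 1).add h.isVectorField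
    simpa [gaugeField, gaugeFieldSum, sub_add_eq_sub_sub] using this
  · have := Submodule.add_mem _ (seriesSum_sub_mem hg 1) h.lengthGE_one
    simpa [gaugeFun, gaugeFunSum] using this
  · rw [hss, hDD, gaugeFieldSum_mul_self hξ hQ hQQ, sub_zero]
  · have := gaugeFieldSum_gaugeFunSum hξ hQ h.lengthGE_one hQf
    rw [divergence_sub, hdiv, sub_zero, LinearMap.sub_apply, ← this]
    abel
  · filter_upwards [Filter.eventually_ge_atTop p] with N hN
    rw [gaugePartialSum_eq]
    refine ⟨?_, ?_, ?_⟩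
    · have := (isVectorField_operatorSum_sub hq (N + 1)).mono (p := p + 1) (by omega)
      simpa [gaugeFieldSum] using this
    · have := Submodule.sub_mem (parityPart k l n 0) (seriesSum_mem_parityPart hg hgp)
        (Submodule.sum_mem _ fun r (_ : r ∈ Finset.range (N + 1)) => hgp r)
      exact this
    · exact lengthGE_mono (by omega) (seriesSum_sub_mem hg (N + 1))

end GaugeAction

/-! ### The linear vector field of the differential -/

section Partials

variable {k : Type*} [Field k] {l n : ℕ}

theorem partialEven_evenCoord (t j : Fin n) :
    partialEven t (evenCoord j : FormalFun k l n) = if t = j then 1 else 0 :=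
  (partialCoord_coord (k := k) (l := l) (Sum.inl t) (Sum.inl j)).trans (by simp)

theorem partialEven_oddCoord (t : Fin n) (i : Fin l) :
    partialEven t (oddCoord i : FormalFun k l n) = 0 :=
  (partialCoord_coord (k := k) (Sum.inl t) (Sum.inr i)).trans (by simp)

theorem partialOdd_evenCoord (t : Fin l) (j : Fin n) :
    partialOdd t (evenCoord j : FormalFun k l n) = 0 :=
  (partialCoord_coord (k := k) (Sum.inr t) (Sum.inl j)).trans (by simp)

theorem partialOdd_oddCoord (t i : Fin l) :
    partialOdd t (oddCoord i : FormalFun k l n) = if t = i then 1 else 0 :=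
  (partialCoord_coord (k := k) (n := n) (Sum.inr t) (Sum.inr i)).trans (by simp)

end Partials

section LinearField

variable {k : Type*} [Field k] {V₀ V₁ : Type*} [AddCommGroup V₀] [Module k V₀]
  [AddCommGroup V₁] [Module k V₁] {l n : ℕ} (b₀ : Module.Basis (Fin l) k V₀)
  (b₁ : Module.Basis (Fin n) k V₁) (d₀ : V₀ →ₗ[k] V₁) (d₁ : V₁ →ₗ[k] V₀)

theorem isVectorField_linearField : IsVectorField 1 1 (linearField b₀ b₁ d₀ d₁) := by
  refine IsVectorField.add (IsVectorField.sum _ fun j _ => ?_) (IsVectorField.sum _ fun i _ => ?_)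
  · exact isVectorField_mulLeft_partialCoord (z := Sum.inl j)
      (Submodule.sum_mem _ fun i _ => Submodule.smul_mem _ _ (coord_mem_parityPart (Sum.inr i)))
      (Submodule.sum_mem _ fun i _ => Submodule.smul_mem _ _ (coord_mem_lengthGE (Sum.inr i)))
  · exact isVectorField_mulLeft_partialCoord (z := Sum.inr i)
      (Submodule.sum_mem _ fun j _ => Submodule.smul_mem _ _ (coord_mem_parityPart (Sum.inl j)))
      (Submodule.sum_mem _ fun j _ => Submodule.smul_mem _ _ (coord_mem_lengthGE (Sum.inl j)))

theorem linearField_evenCoord (j : Fin n) : linearField b₀ b₁ d₀ d₁ (evenCoord j) =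
    ∑ i, b₁.coord j (d₀ (b₀ i)) • (oddCoord i : FormalFun k l n) := by
  simp [linearField, LinearMap.sum_apply, partialEven_evenCoord, partialOdd_evenCoord]

theorem linearField_oddCoord (i : Fin l) : linearField b₀ b₁ d₀ d₁ (oddCoord i) =
    ∑ j, b₀.coord i (d₁ (b₁ j)) • (evenCoord j : FormalFun k l n) := by
  simp [linearField, LinearMap.sum_apply, partialEven_oddCoord, partialOdd_oddCoord]

theorem divergence_linearField : divergence 1 (linearField b₀ b₁ d₀ d₁) = 0 := by
  simp [divergence, linearField_evenCoord, linearField_oddCoord, partialEven_oddCoord,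
    partialOdd_evenCoord]

theorem sum_coord_mul_coord {V W ι κ : Type*} [AddCommGroup V] [Module k V] [AddCommGroup W]
    [Module k W] [Fintype ι] [Fintype κ] {u : V →ₗ[k] W} {v : W →ₗ[k] V} (h : u ∘ₗ v = 0)
    (b : Module.Basis ι k V) (c : Module.Basis κ k W) (j t : κ) :
    ∑ i, c.coord j (u (b i)) * b.coord i (v (c t)) = 0 := by
  have := congrArg (c.coord j) (LinearMap.congr_fun h (c t))
  rw [LinearMap.comp_apply, ← b.sum_repr (v (c t)), map_sum, map_sum] at this
  simpa [mul_comm] using this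

/-- A square of operators is not visibly a derivation, but [D, D] = 2 D² is, so it is enough to
evaluate on coordinates. -/
theorem linearField_mul_self [CharZero k] (hd₀ : d₁ ∘ₗ d₀ = 0) (hd₁ : d₀ ∘ₗ d₁ = 0) :
    linearField b₀ b₁ d₀ d₁ * linearField b₀ b₁ d₀ d₁ = 0 := by
  have hD := isVectorField_linearField b₀ b₁ d₀ d₁
  have e : superBracket 1 1 (linearField b₀ b₁ d₀ d₁) (linearField b₀ b₁ d₀ d₁) =
      (2 : k) • (linearField b₀ b₁ d₀ d₁ * linearField b₀ b₁ d₀ d₁) := by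
    rw [superBracket_one_one, two_smul]
  refine (smul_eq_zero_iff_right (two_ne_zero (α := k))).mp ?_
  rw [← e]
  refine (hD.superBracket hD (r := 1) le_rfl).eq_zero fun z => ?_
  rw [e, LinearMap.smul_apply, Module.End.mul_apply]
  refine (congrArg _ ?_).trans (smul_zero (2 : k))
  rcases z with j | i
  · change linearField b₀ b₁ d₀ d₁ (linearField b₀ b₁ d₀ d₁ (evenCoord j)) = 0
    rw [linearField_evenCoord, map_sum]
    simp only [map_smul, linearField_oddCoord, Finset.smul_sum, smul_smul]
    rw [Finset.sum_comm]
    refine Finset.sum_eq_zero fun t _ => ?_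
    rw [← Finset.sum_smul, sum_coord_mul_coord hd₁ b₀ b₁, zero_smul]
  · change linearField b₀ b₁ d₀ d₁ (linearField b₀ b₁ d₀ d₁ (oddCoord i)) = 0
    rw [linearField_oddCoord, map_sum]
    simp only [map_smul, linearField_evenCoord, Finset.smul_sum, smul_smul]
    rw [Finset.sum_comm]
    refine Finset.sum_eq_zero fun t _ => ?_
    rw [← Finset.sum_smul, sum_coord_mul_coord hd₀ b₁ b₀, zero_smul]

end LinearField

/-! ### Solving for the gauge parameter by contraction -/

section FixedPoint

variable {k : Type*} [Field k] {l n : ℕ}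

theorem gaugeFunSum_mem_lengthGE {ξ : Module.End k (FormalFun k l n)} (hξ : IsVectorField 0 2 ξ)
    {f : FormalFun k l n} (hf : f ∈ lengthGE k l n 1) : gaugeFunSum ξ f ∈ lengthGE k l n 1 := by
  have := Submodule.add_mem _ (seriesSum_sub_mem (gaugeFun_mem_lengthGE hξ hf) 1) hf
  simpa [gaugeFun, gaugeFunSum] using this

theorem gaugeFunSum_mem_parityPart {ξ : Module.End k (FormalFun k l n)} (hξ : IsVectorField 0 2 ξ)
    {f : FormalFun k l n} (hf : f ∈ lengthGE k l n 1) (hp : f ∈ parityPart k l n 0) :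
    gaugeFunSum ξ f ∈ parityPart k l n 0 :=
  seriesSum_mem_parityPart (gaugeFun_mem_lengthGE hξ hf) (gaugeFun_mem_parityPart hξ hp)

theorem gaugeFun_succ_sub_mem {ξ η : Module.End k (FormalFun k l n)} {p : ℕ}
    (hξ : IsVectorField 0 2 ξ) (hη : IsVectorField 0 2 η) (hd : IsVectorField 0 (p + 1) (ξ - η))
    {f : FormalFun k l n} (hf : f ∈ lengthGE k l n 1) (r : ℕ) :
    gaugeFun ξ f (r + 1) - gaugeFun η f (r + 1) ∈ lengthGE k l n (p + r) := by
  rw [gaugeFun, gaugeFun, ← smul_sub]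
  refine Submodule.smul_mem _ _ ?_
  have hw : η f + (2⁻¹ : k) • divergence 0 η ∈ lengthGE k l n 1 :=
    Submodule.add_mem _ (hη.map_lengthGE (by omega) hf)
      (Submodule.smul_mem _ _ hη.divergence_mem_lengthGE)
  induction r with
  | zero =>
    have e : ξ f + (2⁻¹ : k) • divergence 0 ξ - (η f + (2⁻¹ : k) • divergence 0 η) =
        (ξ - η) f + (2⁻¹ : k) • divergence 0 (ξ - η) := by
      rw [divergence_sub, LinearMap.sub_apply, smul_sub]; abel
    rw [pow_zero, pow_zero, Module.End.one_apply, Module.End.one_apply, e]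
    exact Submodule.add_mem _ (hd.map_lengthGE (by omega) hf)
      (Submodule.smul_mem _ _ hd.divergence_mem_lengthGE)
  | succ r ih =>
    rw [pow_succ', pow_succ', Module.End.mul_apply, Module.End.mul_apply]
    set a := (ξ ^ r) (ξ f + (2⁻¹ : k) • divergence 0 ξ)
    have hb := hη.pow_apply_mem_lengthGE hw r
    set b := (η ^ r) (η f + (2⁻¹ : k) • divergence 0 η)
    -- Either the arguments differ, and ξ raises the length of the difference by one, or the fields
    -- differ, and b already has length r + 1.
    have e : ξ a - η b = ξ (a - b) + (ξ - η) b := by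
      rw [map_sub, LinearMap.sub_apply]; abel
    rw [e]
    exact Submodule.add_mem _ (hξ.map_lengthGE (by omega) ih) (hd.map_lengthGE (by omega) hb)

/-- Linearisation of the action: only ½∇(ξ - η) can have length as low as p. The term (ξ - η) f is
longer because f has no constant term, and the terms of order at least 2 gain a length from another
application of a field. -/
theorem gaugeFunSum_sub_mem {ξ η : Module.End k (FormalFun k l n)} {p : ℕ}
    (hξ : IsVectorField 0 2 ξ) (hη : IsVectorField 0 2 η) (hd : IsVectorField 0 (p + 1) (ξ - η))
    {f : FormalFun k l n} (hf : f ∈ lengthGE k l n 1) :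
    gaugeFunSum ξ f - gaugeFunSum η f - (2⁻¹ : k) • divergence 0 (ξ - η) ∈
      lengthGE k l n (p + 1) := by
  have h1 := seriesSum_sub_mem (gaugeFun_mem_lengthGE hξ hf) (p + 2)
  have h2 := seriesSum_sub_mem (gaugeFun_mem_lengthGE hη hf) (p + 2)
  have h3 : ∑ r ∈ Finset.range p, (gaugeFun ξ f (r + 1 + 1) - gaugeFun η f (r + 1 + 1)) ∈
      lengthGE k l n (p + 1) := Submodule.sum_mem _ fun r _ =>
    lengthGE_mono (by omega) (gaugeFun_succ_sub_mem hξ hη hd hf (r + 1))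
  have h4 : (ξ - η) f ∈ lengthGE k l n (p + 1) := hd.map_lengthGE (by omega) hf
  have e : ∀ ξ : Module.End k (FormalFun k l n), ∑ r ∈ Finset.range (p + 2), gaugeFun ξ f r =
      ∑ r ∈ Finset.range p, gaugeFun ξ f (r + 1 + 1) + (ξ f + (2⁻¹ : k) • divergence 0 ξ) + f :=
    fun ξ => by
      rw [Finset.sum_range_succ', Finset.sum_range_succ']
      simp [gaugeFun]
  rw [e] at h1 h2
  have := Submodule.add_mem _ (Submodule.add_mem _ (Submodule.sub_mem _
    (lengthGE_mono (Nat.le_succ (p + 1)) h1) (lengthGE_mono (Nat.le_succ (p + 1)) h2)) h3) h4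
  convert this using 1
  rw [divergence_sub, Finset.sum_sub_distrib, LinearMap.sub_apply, smul_sub, gaugeFunSum,
    gaugeFunSum]
  abel

/-- The contraction principle for the length filtration: the iterates of 0 form a telescoping
series, whose sum exists coefficientwise. -/
theorem exists_fixedPoint {F : FormalFun k l n → FormalFun k l n} {i : ZMod 2}
    (hF : ∀ u ∈ parityPart k l n i, u ∈ lengthGE k l n 1 →
      F u ∈ parityPart k l n i ∧ F u ∈ lengthGE k l n 1)
    (hc : ∀ u ∈ parityPart k l n i, u ∈ lengthGE k l n 1 → ∀ v ∈ parityPart k l n i,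
      v ∈ lengthGE k l n 1 → ∀ p, u - v ∈ lengthGE k l n (p + 1) →
      F u - F v ∈ lengthGE k l n (p + 2)) :
    ∃ u ∈ parityPart k l n i, u ∈ lengthGE k l n 1 ∧ F u = u := by
  set v : ℕ → FormalFun k l n := fun r => F^[r] 0 with hv
  have hs : ∀ r, v (r + 1) = F (v r) := fun r => Function.iterate_succ_apply' F r 0
  have hW : ∀ r, v r ∈ parityPart k l n i ∧ v r ∈ lengthGE k l n 1 := fun r => by
    induction r with
    | zero => exact ⟨Submodule.zero_mem _, Submodule.zero_mem _⟩
    | succ r ih => rw [hs]; exact hF _ ih.1 ih.2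
  have hd : ∀ r, v (r + 1) - v r ∈ lengthGE k l n (r + 1) := fun r => by
    induction r with
    | zero => exact Submodule.sub_mem _ (hW 1).2 (hW 0).2
    | succ r ih =>
      rw [hs (r + 1)]
      conv => arg 2; arg 2; rw [hs r]
      exact hc _ (hW _).1 (hW _).2 _ (hW _).1 (hW _).2 r ih
  have hd' : ∀ r, v (r + 1) - v r ∈ lengthGE k l n r := fun r =>
    lengthGE_mono (Nat.le_succ r) (hd r)
  set u := seriesSum fun r => v (r + 1) - v r with hu
  have hlim : ∀ N, u - v N ∈ lengthGE k l n N := fun N => by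
    have := seriesSum_sub_mem hd' N
    rwa [Finset.sum_range_sub, show v 0 = 0 from rfl, sub_zero] at this
  have hu0 : u ∈ parityPart k l n i :=
    seriesSum_mem_parityPart hd' fun r => Submodule.sub_mem _ (hW _).1 (hW _).1
  have hu1 : u ∈ lengthGE k l n 1 := by
    have := Submodule.add_mem _ (hlim 1) (hW 1).2
    rwa [sub_add_cancel] at this
  refine ⟨u, hu0, hu1, sub_eq_zero.mp (eq_zero_of_forall_mem_lengthGE fun N => ?_)⟩
  -- Modulo length N + 2, F u agrees with F (v (N + 1)) = v (N + 2), hence with u.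
  have h1 := hc u hu0 hu1 _ (hW (N + 1)).1 (hW (N + 1)).2 N (hlim (N + 1))
  rw [← hs] at h1
  have := Submodule.sub_mem _ h1 (hlim (N + 2))
  rw [sub_sub_sub_cancel_right] at this
  exact lengthGE_mono (Nat.le_add_right N 2) this

/-- A section `s` of the divergence up to an error `τ` yields an even vector field `s u` whose gauge
action moves `f` into the image of `τ`. -/
theorem exists_gaugeFunSum_eq [CharZero k]
    {s : FormalFun k l n →ₗ[k] Module.End k (FormalFun k l n)} {τ : Module.End k (FormalFun k l n)}
    (hs : ∀ p, ∀ u ∈ parityPart k l n 0, u ∈ lengthGE k l n p → IsVectorField 0 (p + 1) (s u))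
    (hdiv : ∀ u ∈ parityPart k l n 0, divergence 0 (s u) = u - τ u) {f : FormalFun k l n}
    (hf : f ∈ lengthGE k l n 1) (hp : f ∈ parityPart k l n 0) :
    ∃ ξ u, IsVectorField 0 2 ξ ∧ gaugeFunSum ξ f = τ u := by
  -- A fixed point satisfies u = u - τ u - 2 f', that is, f' = -½ τ u. Subtracting 2 f' cancels the
  -- leading term ∇(s u), which is what makes F a contraction.
  set F : FormalFun k l n → FormalFun k l n :=
    fun u => divergence 0 (s u) - (2 : k) • gaugeFunSum (s u) f with hF
  have hmaps : ∀ u ∈ parityPart k l n 0, u ∈ lengthGE k l n 1 →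
      F u ∈ parityPart k l n 0 ∧ F u ∈ lengthGE k l n 1 := fun u hu0 hu1 => by
    have h := hs 1 u hu0 hu1
    exact ⟨Submodule.sub_mem _ h.divergence_mem_parityPart
        (Submodule.smul_mem _ _ (gaugeFunSum_mem_parityPart h hf hp)),
      Submodule.sub_mem _ h.divergence_mem_lengthGE
        (Submodule.smul_mem _ _ (gaugeFunSum_mem_lengthGE h hf))⟩
  have hcontr : ∀ u ∈ parityPart k l n 0, u ∈ lengthGE k l n 1 → ∀ v ∈ parityPart k l n 0,
      v ∈ lengthGE k l n 1 → ∀ p, u - v ∈ lengthGE k l n (p + 1) →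
      F u - F v ∈ lengthGE k l n (p + 2) := fun u hu0 hu1 v hv0 hv1 p huv => by
    have hd : IsVectorField 0 (p + 1 + 1) (s u - s v) := by
      rw [← map_sub]
      exact hs (p + 1) _ (Submodule.sub_mem _ hu0 hv0) huv
    have h := Submodule.smul_mem _ (-2 : k)
      (gaugeFunSum_sub_mem (hs 1 u hu0 hu1) (hs 1 v hv0 hv1) hd hf)
    have e : F u - F v = (-2 : k) • (gaugeFunSum (s u) f - gaugeFunSum (s v) f -
        (2⁻¹ : k) • divergence 0 (s u - s v)) := by
      rw [smul_sub, smul_smul, neg_mul, mul_inv_cancel₀ two_ne_zero, divergence_sub]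
      module
    rw [e]
    exact h
  obtain ⟨u, hu0, hu1, hu⟩ := exists_fixedPoint hmaps hcontr
  refine ⟨s u, -((2⁻¹ : k) • u), hs 1 u hu0 hu1, ?_⟩
  rw [hF] at hu
  beta_reduce at hu
  rw [hdiv u hu0, sub_sub, sub_eq_self] at hu
  rw [map_neg, map_smul, eq_neg_of_add_eq_zero_left hu, smul_neg, neg_neg, smul_smul,
    inv_mul_cancel₀ two_ne_zero, one_smul]

end FixedPoint

/-! ### Sections of the divergence -/

section Sections

variable {k : Type*} [Field k] {l n : ℕ}

theorem divergence_mulLeft_partialCoord (i : ZMod 2) (z : CoordIdx l n) (a : FormalFun k l n) :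
    divergence i (LinearMap.mulLeft k a * partialCoord k z) =
      sgn k ((i + coordParity z) * coordParity z) • partialCoord k z a := by
  rw [divergence_eq_sum, Finset.sum_eq_single z]
  · rw [Module.End.mul_apply, LinearMap.mulLeft_apply, partialCoord_coord, if_pos rfl, mul_one]
  · intro w _ hw
    rw [Module.End.mul_apply, LinearMap.mulLeft_apply, partialCoord_coord, if_neg hw.symm, mul_zero,
      map_zero, smul_zero]
  · simp

theorem divergence_mulLeft_partialEven (j : Fin n) (a : FormalFun k l n) :
    divergence 0 (LinearMap.mulLeft k a * partialCoord k (Sum.inl j)) = partialEven j a := by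
  have h := divergence_mulLeft_partialCoord (k := k) (l := l) 0 (Sum.inl j) a
  rwa [show coordParity (Sum.inl j : CoordIdx l n) = 0 from rfl, mul_zero, sgn_zero, one_smul] at h

theorem divergence_mulLeft_partialOdd (i : Fin l) (a : FormalFun k l n) :
    divergence 0 (LinearMap.mulLeft k a * partialCoord k (Sum.inr i)) = -partialOdd i a := by
  have h := divergence_mulLeft_partialCoord (k := k) (n := n) 0 (Sum.inr i) a
  rwa [show coordParity (Sum.inr i : CoordIdx l n) = 1 from rfl, mul_one, zero_add, sgn_one,
    neg_one_smul] at h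

/-- The linear map sending `a` to the vector field `φ(a) ∂_z`. -/
def fieldOf (φ : Module.End k (FormalFun k l n)) (z : CoordIdx l n) :
    FormalFun k l n →ₗ[k] Module.End k (FormalFun k l n) where
  toFun a := LinearMap.mulLeft k (φ a) * partialCoord k z
  map_add' a b := by
    ext1 c
    simp [add_mul]
  map_smul' c a := by
    ext1 b
    simp

theorem fieldOf_apply (φ : Module.End k (FormalFun k l n)) (z : CoordIdx l n)
    (a : FormalFun k l n) : fieldOf φ z a = LinearMap.mulLeft k (φ a) * partialCoord k z := rfl

/-- Formal integration in the variable `y_j`. -/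
def integralEven (j : Fin n) : Module.End k (FormalFun k l n) where
  -- For e j = 0 the inverse is 0, which discards the coefficient misread by the truncated
  -- subtraction: the primitive has no terms free of y_j.
  toFun a := fun e => ((e j : k)⁻¹) • MvPowerSeries.coeff (e - Finsupp.single j 1) a
  map_add' a b := by
    ext e
    change ((e j : k)⁻¹) • MvPowerSeries.coeff (e - Finsupp.single j 1) (a + b) = _
    rw [map_add, smul_add]; rfl
  map_smul' c a := by
    ext e
    exact smul_comm ((e j : k)⁻¹) c (MvPowerSeries.coeff (e - Finsupp.single j 1) a)

theorem coeff_integralEven (j : Fin n) (a : FormalFun k l n) (e : Fin n →₀ ℕ) :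
    MvPowerSeries.coeff e (integralEven j a) =
      ((e j : k)⁻¹) • MvPowerSeries.coeff (e - Finsupp.single j 1) a := rfl

theorem partialEven_integralEven [CharZero k] (j : Fin n) (a : FormalFun k l n) :
    partialEven j (integralEven j a) = a := by
  ext e
  rw [coeff_partialEven, coeff_integralEven, add_tsub_cancel_right, smul_smul, Finsupp.add_apply,
    Finsupp.single_eq_same, Nat.cast_add, Nat.cast_one, mul_inv_cancel₀, one_smul]
  exact_mod_cast Nat.succ_ne_zero (e j)

theorem integralEven_mem_parityPart (j : Fin n) {i : ZMod 2} {a : FormalFun k l n}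
    (ha : a ∈ parityPart k l n i) : integralEven j a ∈ parityPart k l n i := fun _ =>
  Submodule.smul_mem _ _ (ha _)

theorem integralEven_mem_lengthGE (j : Fin n) {p : ℕ} {a : FormalFun k l n}
    (ha : a ∈ lengthGE k l n p) : integralEven j a ∈ lengthGE k l n (p + 1) := fun e => by
  rw [coeff_integralEven]
  by_cases h : e j = 0
  · rw [h, Nat.cast_zero, inv_zero, zero_smul]
    exact Submodule.zero_mem _
  · obtain ⟨e, rfl⟩ := exists_add_single h
    refine Submodule.smul_mem _ _ ?_
    rw [add_tsub_cancel_right]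
    exact extGE_mono (by rw [map_add, Finsupp.degree_single]; omega) (ha e)

/-- The operator `x_i ∂/∂x_i`. -/
def eulerOdd (i : Fin l) : Module.End k (FormalFun k l n) :=
  LinearMap.mulLeft k (oddCoord i) * partialOdd i

theorem oddCoord_mem_parityPart (i : Fin l) : (oddCoord i : FormalFun k l n) ∈ parityPart k l n 1 :=
  coord_mem_parityPart (Sum.inr i)

theorem oddCoord_mem_lengthGE (i : Fin l) : (oddCoord i : FormalFun k l n) ∈ lengthGE k l n 1 :=
  coord_mem_lengthGE (Sum.inr i)

/-- For one coordinate the field -(x_i a) ∂_i has divergence ∂_i (x_i a) = a - x_i ∂_i a. Applying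
this to a = τ u, the error left by the earlier coordinates, telescopes. -/
theorem exists_odd_section (L : List (Fin l)) :
    ∃ s : FormalFun k l n →ₗ[k] Module.End k (FormalFun k l n),
      (∀ p, ∀ u ∈ parityPart k l n 0, u ∈ lengthGE k l n p → IsVectorField 0 (p + 1) (s u)) ∧
      ∀ u ∈ parityPart k l n 0, divergence 0 (s u) = u - (L.map eulerOdd).prod u := by
  induction L with
  | nil => exact ⟨0, fun p u _ _ => isVectorField_zero, fun u _ => by simp [divergence_zero]⟩
  | cons i L ih =>
    obtain ⟨s, hs, hdiv⟩ := ih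
    set τ := (L.map (eulerOdd (k := k) (n := n))).prod with hτ
    -- Written as u - ∇(s u), the error visibly keeps parity and length.
    have hτu : ∀ u ∈ parityPart k l n 0, τ u = u - divergence 0 (s u) := fun u hu => by
      rw [hdiv u hu]; abel
    have hτ0 : ∀ u ∈ parityPart k l n 0, τ u ∈ parityPart k l n 0 := fun u hu => by
      rw [hτu u hu]
      exact Submodule.sub_mem _ hu (hs 0 u hu (mem_lengthGE_zero u)).divergence_mem_parityPart
    have hτp : ∀ p, ∀ u ∈ parityPart k l n 0, u ∈ lengthGE k l n p → τ u ∈ lengthGE k l n p :=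
      fun p u hu hup => by
        rw [hτu u hu]
        exact Submodule.sub_mem _ hup (hs p u hu hup).divergence_mem_lengthGE
    refine ⟨s + fieldOf (k := k) (n := n) (-(LinearMap.mulLeft k (oddCoord i) * τ)) (Sum.inr i),
      fun p u hu hup => ?_, fun u hu => ?_⟩
    · have h0 : -(oddCoord i * τ u) ∈ parityPart k l n (1 + 0) :=
        Submodule.neg_mem _ (parityPart_mul (oddCoord_mem_parityPart i) (hτ0 u hu))
      have h1 : -(oddCoord i * τ u) ∈ lengthGE k l n (1 + p) :=
        Submodule.neg_mem _ (lengthGE_mul (oddCoord_mem_lengthGE i) (hτp p u hu hup))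
      rw [add_comm] at h0 h1
      exact (hs p u hu hup).add (isVectorField_mulLeft_partialCoord (z := Sum.inr i) h0 h1)
    · have e : fieldOf (k := k) (n := n) (-(LinearMap.mulLeft k (oddCoord i) * τ)) (Sum.inr i) u =
        LinearMap.mulLeft k (-(oddCoord i * τ u)) * partialCoord k (Sum.inr i) := rfl
      have e' : eulerOdd i (τ u) = oddCoord i * partialOdd i (τ u) := rfl
      rw [LinearMap.add_apply, divergence_add, hdiv u hu, e, divergence_mulLeft_partialOdd, map_neg,
        neg_neg, partialOdd_mul i (oddCoord_mem_parityPart i), sgn_one, partialOdd_oddCoord,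
        if_pos rfl, one_mul, neg_one_smul, List.map_cons, List.prod_cons, ← hτ,
        Module.End.mul_apply, e']
      abel

theorem prod_oddCoord_mem_parityPart (L : List (Fin l)) :
    (L.map (oddCoord (k := k) (n := n))).prod ∈ parityPart k l n (L.length : ZMod 2) := by
  induction L with
  | nil => simpa using one_mem_parityPart (k := k) (l := l) (n := n)
  | cons i L ih =>
    rw [List.map_cons, List.prod_cons, List.length_cons, Nat.cast_add, Nat.cast_one, add_comm]
    exact parityPart_mul (oddCoord_mem_parityPart i) ih

theorem prod_oddCoord_mem_lengthGE (L : List (Fin l)) :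
    (L.map (oddCoord (k := k) (n := n))).prod ∈ lengthGE k l n L.length := by
  induction L with
  | nil => exact mem_lengthGE_zero _
  | cons i L ih =>
    rw [List.map_cons, List.prod_cons, List.length_cons, add_comm]
    exact lengthGE_mul (oddCoord_mem_lengthGE i) ih

theorem partialOdd_prod_oddCoord {i : Fin l} {L : List (Fin l)} (h : i ∉ L) :
    partialOdd i (L.map (oddCoord (k := k) (n := n))).prod = 0 := by
  induction L with
  | nil => exact (isVectorField_partialCoord (k := k) (n := n) (Sum.inr i)).map_one
  | cons j L ih =>
    rw [List.mem_cons, not_or] at h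
    rw [List.map_cons, List.prod_cons, partialOdd_mul i (oddCoord_mem_parityPart j), ih h.2,
      partialOdd_oddCoord, if_neg h.1, zero_mul, mul_zero, smul_zero, add_zero]

/-- The derivative ∂_i passes the product of the other odd coordinates at the cost of a sign, so all
the x_i collect on the left. Distinctness ensures that ∂_i kills that product. -/
theorem exists_prod_eulerOdd_eq {L : List (Fin l)} (h : L.Nodup) (u : FormalFun k l n) :
    ∃ b, (L.map eulerOdd).prod u = (L.map oddCoord).prod * b := by
  induction L with
  | nil => exact ⟨u, by simp⟩
  | cons i L ih =>
    rw [List.nodup_cons] at h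
    obtain ⟨b, hb⟩ := ih h.2
    refine ⟨sgn k (L.length : ZMod 2) • partialOdd i b, ?_⟩
    rw [List.map_cons, List.prod_cons, Module.End.mul_apply, hb, List.map_cons, List.prod_cons]
    have e : ∀ a : FormalFun k l n, eulerOdd i a = oddCoord i * partialOdd i a := fun _ => rfl
    rw [e, partialOdd_mul i (prod_oddCoord_mem_parityPart L), partialOdd_prod_oddCoord h.1, zero_mul,
      zero_add, mul_smul_comm, mul_smul_comm, mul_assoc]

theorem topMonomial_eq : topMonomial k l n = ((List.finRange l).map oddCoord).prod := by
  rw [topMonomial, List.ofFn_eq_map]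

theorem topMonomial_mem_parityPart : topMonomial k l n ∈ parityPart k l n (l : ZMod 2) := by
  rw [topMonomial_eq]
  simpa using prod_oddCoord_mem_parityPart (k := k) (n := n) (List.finRange l)

theorem topMonomial_mem_lengthGE : topMonomial k l n ∈ lengthGE k l n l := by
  rw [topMonomial_eq]
  simpa using prod_oddCoord_mem_lengthGE (k := k) (n := n) (List.finRange l)

theorem eq_zero_of_mem_lengthGE {a : FormalFun k l 0} (ha : a ∈ lengthGE k l 0 (l + 1)) : a = 0 := by
  ext e
  rw [coeff_eq_zero_of_mem_lengthGE ha, map_zero]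
  rw [Subsingleton.elim e 0, map_zero]
  omega

/-- Without even coordinates nothing has length above l, so only the constant term of the cofactor
survives multiplication by the top monomial. -/
theorem exists_prod_eulerOdd_eq_smul (u : FormalFun k l 0) :
    ∃ c : k, ((List.finRange l).map eulerOdd).prod u = c • topMonomial k l 0 := by
  obtain ⟨b, hb⟩ := exists_prod_eulerOdd_eq (List.nodup_finRange l) u
  obtain ⟨c, hc⟩ := exists_sub_smul_one_mem b
  refine ⟨c, ?_⟩
  have := eq_zero_of_mem_lengthGE (lengthGE_mul topMonomial_mem_lengthGE hc)
  rw [mul_sub, mul_smul_comm, mul_one, sub_eq_zero, topMonomial_eq, ← hb] at this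
  rw [this, topMonomial_eq]

theorem eq_zero_of_mem_parityPart {a : FormalFun k l n} (h0 : a ∈ parityPart k l n 0)
    (h1 : a ∈ parityPart k l n 1) : a = 0 := by
  ext e
  exact Submodule.disjoint_def.mp (CliffordAlgebra.evenOdd_isCompl _).disjoint _ (h0 e) (h1 e)

end Sections

/-! ### Reduction of unimodular structures -/

section Main

variable {k : Type*} [Field k] [CharZero k] {l n : ℕ} {D m : Module.End k (FormalFun k l n)}
  {f : FormalFun k l n}

theorem IsUnimodular.exists_gaugeEquiv_zero (hD : IsVectorField 1 1 D) (hDD : D * D = 0)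
    (hdiv : divergence 1 D = 0) (h : IsUnimodular D m f) (hn : 0 < n) :
    ∃ m', IsUnimodular D m' 0 ∧ GaugeEquiv D (m, f) (m', 0) := by
  let z : CoordIdx l n := Sum.inl ⟨0, hn⟩
  obtain ⟨ξ, u, hξ, hu⟩ := exists_gaugeFunSum_eq (s := fieldOf (integralEven ⟨0, hn⟩) z) (τ := 0)
    (fun p u hu hup => isVectorField_mulLeft_partialCoord (z := z)
      (integralEven_mem_parityPart _ hu) (integralEven_mem_lengthGE _ hup))
    (fun u _ => by
      rw [fieldOf_apply, divergence_mulLeft_partialEven, partialEven_integralEven,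
        LinearMap.zero_apply, sub_zero])
    h.lengthGE_one h.even
  have hg := h.gauge hD hDD hdiv hξ
  rw [hu, LinearMap.zero_apply] at hg
  exact ⟨_, hg⟩

theorem IsUnimodular.exists_gaugeEquiv_topMonomial {D m : Module.End k (FormalFun k l 0)}
    {f : FormalFun k l 0} (hD : IsVectorField 1 1 D) (hDD : D * D = 0)
    (hdiv : divergence 1 D = 0) (h : IsUnimodular D m f) :
    ∃ (m' : Module.End k (FormalFun k l 0)) (c : k), IsUnimodular D m' (c • topMonomial k l 0) ∧
      GaugeEquiv D (m, f) (m', c • topMonomial k l 0) := by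
  obtain ⟨s, hs, hsd⟩ := exists_odd_section (k := k) (n := 0) (List.finRange l)
  obtain ⟨ξ, u, hξ, hu⟩ := exists_gaugeFunSum_eq hs hsd h.lengthGE_one h.even
  obtain ⟨c, hc⟩ := exists_prod_eulerOdd_eq_smul u
  have hg := h.gauge hD hDD hdiv hξ
  rw [hu, hc] at hg
  exact ⟨_, c, hg⟩

/-- The field m raises length, so it kills the top monomial, and the function equation reduces to ∇m
= 0. -/
theorem IsUnimodular.zero_of_topMonomial {m : Module.End k (FormalFun k l 0)} {c : k}
    (h : IsUnimodular 0 m (c • topMonomial k l 0)) : IsUnimodular 0 m 0 where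
  isVectorField := h.isVectorField
  even := Submodule.zero_mem _
  lengthGE_one := Submodule.zero_mem _
  mc_field := h.mc_field
  mc_function := by
    have h0 : m (c • topMonomial k l 0) = 0 := eq_zero_of_mem_lengthGE
      (h.isVectorField.map_lengthGE (q := l) (by omega)
        (Submodule.smul_mem _ _ topMonomial_mem_lengthGE))
    have := h.mc_function
    rw [h0] at this
    simpa using this

end Main

end

end UnimodularLInfty

theorem theorem4p4 {k : Type*} [Field k] [CharZero k]
    {V₀ V₁ : Type*} [AddCommGroup V₀] [Module k V₀] [AddCommGroup V₁] [Module k V₁]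
    {l n : ℕ} (b₀ : Module.Basis (Fin l) k V₀) (b₁ : Module.Basis (Fin n) k V₁)
    (d₀ : V₀ →ₗ[k] V₁) (d₁ : V₁ →ₗ[k] V₀) (hd₀ : d₁ ∘ₗ d₀ = 0) (hd₁ : d₀ ∘ₗ d₁ = 0)
    (m : Module.End k (UnimodularLInfty.FormalFun k l n)) (f : UnimodularLInfty.FormalFun k l n)
    (hmf : UnimodularLInfty.IsUnimodular (UnimodularLInfty.linearField b₀ b₁ d₀ d₁) m f) :
    ((0 < n ∨ Odd l) →
      ∃ m' : Module.End k (UnimodularLInfty.FormalFun k l n),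
        UnimodularLInfty.IsUnimodular (UnimodularLInfty.linearField b₀ b₁ d₀ d₁) m' 0 ∧
        UnimodularLInfty.GaugeEquiv (UnimodularLInfty.linearField b₀ b₁ d₀ d₁) (m, f) (m', 0)) ∧
    ((n = 0 ∧ Even l) →
      ∃ (m' : Module.End k (UnimodularLInfty.FormalFun k l n)) (c : k),
        UnimodularLInfty.IsUnimodular (UnimodularLInfty.linearField b₀ b₁ d₀ d₁) m' 0 ∧
        UnimodularLInfty.IsUnimodular (UnimodularLInfty.linearField b₀ b₁ d₀ d₁) m'
          (c • UnimodularLInfty.topMonomial k l n) ∧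
        UnimodularLInfty.GaugeEquiv (UnimodularLInfty.linearField b₀ b₁ d₀ d₁) (m, f)
          (m', c • UnimodularLInfty.topMonomial k l n)) := by

  have hD := UnimodularLInfty.isVectorField_linearField b₀ b₁ d₀ d₁
  have hDD := UnimodularLInfty.linearField_mul_self b₀ b₁ d₀ d₁ hd₀ hd₁
  have hdiv := UnimodularLInfty.divergence_linearField b₀ b₁ d₀ d₁
  refine ⟨fun h => ?_, fun ⟨hn, hl⟩ => ?_⟩
  · rcases Nat.eq_zero_or_pos n with rfl | hn
    · have hl : Odd l := h.resolve_left (lt_irrefl 0)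
      obtain ⟨m', c, hm', hg⟩ := hmf.exists_gaugeEquiv_topMonomial hD hDD hdiv
      -- For odd l the top monomial is odd, while the function of a unimodular structure is even;
      -- the residual term is therefore 0.
      have hp : c • UnimodularLInfty.topMonomial k l 0 ∈ UnimodularLInfty.parityPart k l 0 1 := by
        rw [← ZMod.natCast_eq_one_iff_odd.mpr hl]
        exact Submodule.smul_mem _ _ UnimodularLInfty.topMonomial_mem_parityPart
      have h0 := UnimodularLInfty.eq_zero_of_mem_parityPart hm'.even hp
      rw [h0] at hm' hg
      exact ⟨m', hm', hg⟩
    · exact hmf.exists_gaugeEquiv_zero hD hDD hdiv hn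
  · subst hn
    -- The differential sends each x_i to a combination of the y_j, and there are none.
    have hD0 : UnimodularLInfty.linearField b₀ b₁ d₀ d₁ = 0 :=
      hD.eq_zero fun z => by
        rcases z with j | i
        · exact j.elim0
        · exact (UnimodularLInfty.linearField_oddCoord b₀ b₁ d₀ d₁ i).trans (by simp)
    obtain ⟨m', c, hm', hg⟩ := hmf.exists_gaugeEquiv_topMonomial hD hDD hdiv
    refine ⟨m', c, ?_, hm', hg⟩
    rw [hD0] at hm' ⊢
    exact hm'.zero_of_topMonomial
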